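/- **Setting.** Time is slotted, $t=1,2,\dots$. A base station (BS) serves a finite set of users partitioned into $\mathcal I_A$ (age-of-information users), $\mathcal I_L$ (latency users) and $\mathcal I_R$ (throughput users). At the start of each slot a packet arrives for user $\ell\in\mathcal I_A\cup\mathcal I_L$ with probability $q_\ell\in(0,1]$; for $k\in\mathcal I_R$ the BS always has a packet. In each slot the BS transmits at most one packet to at most one user; a transmission to $\ell$ succeeds with probability $p_\ell\in(0,1]$. Arrivals, transmission outcomes and the scheduler's random choices are independent over slots and of each other. Let $\hat R_\ell(t)$ and $R_\ell(t)$ be the numbers of transmission attempts to, and of packets received by, user $\ell$ in slots $1,\dots,t$. The throughput of $\ell$ is $\overline R_\ell=\lim_{t\to\infty}R_\ell(t)/t$. The average latency of $j\in\mathcal I_L$ is $\overline L_j=\lim_{t\to\infty}\overline L_j(t)$, where $\overline L_j(t)$ is the mean of $r-g+1$ over all packets that arrive for $j$ in slots $1,\dots,t$, with $g$ the arrival slot and $r$ the slot of reception, $r=t$ being used if the packet is not received by slot $t$. Constants $\rho_i>0$ ($i\in\mathcal I_A$), $\beta_j>0$ ($j\in\mathcal I_L$), $\alpha_k>0$ ($k\in\mathcal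 I_R$) are given, with $\beta_j\ge1$ whenever $q_j=1$, and $\zeta:=1-\sum_{j\in\mathcal I_L}q_j/p_j-\sum_{k\in\mathcal I_R}\alpha_k/p_k>0$. Let $(\overline T_i^\star)_{i\in\mathcal I_A}$ minimise $\sum_{i}\frac{\rho_i}{2}\big(\overline T_i+\frac{(1-q_i)/q_i^2}{\overline T_i}\big)$ subject to $\sum_i\frac1{p_i\overline T_i}\le\zeta$ and $\overline T_i\ge1$. Put $\theta_j=\frac1{p_j}\big(q_j+\frac{1-q_j}{\beta_j}\big)$ for $j\in\mathcal I_L$. **Policy $\pi_{RD}$.** Initially $W_i=a_i=b_i=0$ for $i\in\mathcal I_A$. In slot $t$: 1. For each $i\in\mathcal I_A$ with an arrival in slot $t$: if $t-a_i>\lceil\overline T_i^\star-1/q_i\rceil$, set $a_i=t$ and increase $b_i$ by $1$; then, if $b_i>R_i(t-1)$, set $W_i=\rho_ip_i(t-\lambda_i(t))$, where $\lambda_i(t)$ is the latest arrival slot among the packets received by $i$ before slot $t$ ($0$ if there is none). 2. If $\max_{i\in\mathcal I_A} W_i>0$, let $\ell^\star\in\arg\max_{i\in\mathcal I_A}W_i$;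 otherwise let $\ell^\star\in\arg\max_{k\in\mathcal I_R}\{\alpha_kt/p_k-\hat R_k(t-1)\}$ (there is no $\ell^\star$ if $\mathcal I_R=\emptyset$). Ties are broken by an arbitrary rule that depends on $t$ and on the BS's current bookkeeping (stored packets, received packets with their reception slots, counters, indices). 3. Let $\mathcal I_L^S$ be the set of $j\in\mathcal I_L$ for which the BS stores a packet. Choose $u\in\mathcal I_L^S\cup\{\ell^\star\}$ at random, $u=j\in\mathcal I_L^S$ with probability $\theta_j$ and $u=\ell^\star$ with probability $1-\sum_{j\in\mathcal I_L^S}\theta_j$, and transmit the latest packet of $u$ (nothing if there is no $\ell^\star$ to choose). If $u\in\mathcal I_A$ and the transmission succeeds, set $W_u=0$. **Theorem.** Assume $\sum_{j\in\mathcal I_L}\theta_j\le1$. Then under $\pi_{RD}$: (i) for every $j\in\mathcal I_L$, $\overline L_j(t)$ converges almost surely, as $t\to\infty$, to a constant $\overline L_j\le\beta_j$; (ii) for every $k\in\mathcal I_R$, almost surely $\limsup_{t\to\infty}R_k(t)/t\ge\alpha_k$, so that $\overline R_k\ge\alpha_k$ whenever the limit defining the throughput $\overline R_k$ exists; moreover,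 almost surely, if the throughputs $\overline R_i$ of all AoI users $i\in\mathcal I_A$ exist, then $\overline R_k$ exists as well, and $\overline R_k\ge\alpha_k$. -/

import Mathlib

open MeasureTheory ProbabilityTheory Filter Topology

noncomputable section

namespace RDScheduling

/-- The users, partitioned into AoI users (`A`), latency users (`L`) and throughput users (`R`). -/
inductive UE (A L R : Type*) where
  | aoi (i : A)
  | lat (j : L)
  | thr (k : R)
  deriving DecidableEq, Fintype

/-- The parameters of the network. Users in `R` always have a packet to transmit at the base station,
so they have no arrival rate. -/
structure Params (A L R : Type*) where
  /-- success probability of a transmission -/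
  p : UE A L R → ℝ
  /-- arrival probability per slot, AoI users -/
  qA : A → ℝ
  /-- arrival probability per slot, latency users -/
  qL : L → ℝ
  /-- weights of the AoI users -/
  ρ : A → ℝ
  /-- largest tolerable average latency -/
  β : L → ℝ
  /-- required throughput -/
  α : R → ℝ
  p_pos : ∀ u, 0 < p u
  p_le : ∀ u, p u ≤ 1
  qA_pos : ∀ i, 0 < qA i
  qA_le : ∀ i, qA i ≤ 1
  qL_pos : ∀ j, 0 < qL j
  qL_le : ∀ j, qL j ≤ 1
  ρ_pos : ∀ i, 0 < ρ i
  β_pos : ∀ j, 0 < β j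
  α_pos : ∀ k, 0 < α k

variable {A L R : Type*} [Fintype A] [Fintype L] [Fintype R]
  [DecidableEq A] [DecidableEq L] [DecidableEq R]

/-- `ζ = 1 - ∑ q_j / p_j - ∑ α_k / p_k`. -/
def Params.ζ (P : Params A L R) : ℝ :=
  1 - ∑ j, P.qL j / P.p (.lat j) - ∑ k, P.α k / P.p (.thr k)

/-- `θ_j = (q_j + (1 - q_j) / β_j) / p_j`. -/
def Params.θ (P : Params A L R) (j : L) : ℝ :=
  (P.qL j + (1 - P.qL j) / P.β j) / P.p (.lat j)

/-- Feasible points of the program that fixes the target inter-arrival times. -/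
def Params.targetFeasible (P : Params A L R) : Set (A → ℝ) :=
  {T | ∑ i, 1 / (P.p (.aoi i) * T i) ≤ P.ζ ∧ ∀ i, 1 ≤ T i}

/-- Objective of the program that fixes the target inter-arrival times. -/
def Params.targetCost (P : Params A L R) (T : A → ℝ) : ℝ :=
  ∑ i, P.ρ i / 2 * (T i + ((1 - P.qA i) / P.qA i ^ 2) / T i)

/-- `T` is a minimiser of the program (the vector of the `T̄_i^⋆`). -/
def Params.IsTarget (P : Params A L R) (T : A → ℝ) : Prop :=
  T ∈ P.targetFeasible ∧ IsMinOn P.targetCost P.targetFeasible T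

/-! ### Randomness -/

/-- All the randomness of one slot. `token` is the randomisation of the scheduler;
`chan u` says whether a transmission to `u` in this slot would succeed. -/
structure Input (A L R : Type*) where
  arrA : A → Bool
  arrL : L → Bool
  chan : UE A L R → Bool
  token : Option L

instance : MeasurableSpace (Input A L R) := ⊤

/-- Point mass of a Bernoulli variable. -/
def bern (x : ℝ) (b : Bool) : ℝ := if b then x else 1 - x

/-- Law of the token: `j` with probability `θ_j`, nothing with the remaining probability. -/
def Params.tokenProb (P : Params A L R) : Option L → ℝ
  | some j => P.θ j
  | none => 1 - ∑ j, P.θ j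

/-- Law of the randomness of one slot: everything is independent, a packet arrives for `ℓ` with
probability `q_ℓ`, a transmission to `ℓ` succeeds with probability `p_ℓ`. -/
def Params.inputProb (P : Params A L R) (z : Input A L R) : ℝ :=
  (∏ i, bern (P.qA i) (z.arrA i)) * (∏ j, bern (P.qL j) (z.arrL j)) *
    (∏ u, bern (P.p u) (z.chan u)) * P.tokenProb z.token

/-- `Z t`, `t = 1, 2, …`, are independent, each with law `inputProb`. -/
structure IsDriver (P : Params A L R) {Ω : Type*} [MeasurableSpace Ω] (μ : Measure Ω)
    (Z : ℕ → Ω → Input A L R) : Prop where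
  measurable : ∀ t, Measurable (Z t)
  indep : iIndepFun Z μ
  law : ∀ t z, μ.real {ω | Z t ω = z} = P.inputProb z

/-- Random choice of the user to be served, given the set `S` of latency users with a stored packet:
`some j` means `j ∈ S`, `none` means the best user `ℓ⋆` of `I_A ∪ I_R`. -/
def pick (S : Finset L) (token : Option L) : Option L :=
  token.filter (fun j => decide (j ∈ S))

/-- With `pick`, every `j ∈ S` is chosen with probability `θ_j`. -/
theorem sum_pick_some (P : Params A L R) (S : Finset L) (j : L) :
    ∑ x : Option L, (if pick S x = some j then P.tokenProb x else 0) =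
      if j ∈ S then P.θ j else 0 := by
  rw [Fintype.sum_option]
  by_cases h : j ∈ S
  · rw [Finset.sum_eq_single j]
    · simp [pick, h, Params.tokenProb, Option.filter]
    · intro b _ hb
      simp [pick, Option.filter]
      intro _ h'
      exact absurd h' hb
    · simp
  · simp only [pick, Option.filter, h, if_false]
    simp
    refine Finset.sum_eq_zero fun x _ => if_neg ?_
    rintro ⟨hx, rfl⟩
    exact h hx

/-- With `pick`, the best user of `I_A ∪ I_R` is chosen with probability `1 - ∑_{j ∈ S} θ_j`. -/
theorem sum_pick_none (P : Params A L R) (S : Finset L) :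
    ∑ x : Option L, (if pick S x = none then P.tokenProb x else 0) = 1 - ∑ j ∈ S, P.θ j := by
  rw [Fintype.sum_option]
  have h : ∑ x : L, (if pick S (some x) = none then P.tokenProb (some x) else 0) =
      ∑ j ∈ Sᶜ, P.θ j := by
    rw [← Finset.sum_filter]
    congr 1
    ext x
    simp [pick, Option.filter]
  rw [h, if_pos (by simp [pick]), Params.tokenProb, ← Finset.sum_add_sum_compl S P.θ]
  ring

/-! ### The policy -/

/-- What the base station keeps track of. A packet of a given user is named by the slot in which it
arrived. -/
structure State (A L R : Type*) where
  /-- slot of the latest increment of the counter `b` -/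
  a : A → ℕ
  /-- threshold-based counter -/
  b : A → ℕ
  /-- index -/
  W : A → ℝ
  /-- arrival slot of the latest packet that has arrived -/
  latest : A → ℕ
  /-- arrival slot `λ` of the latest packet that has been received (`0` if there is none) -/
  lam : A → ℕ
  /-- stored packets of the latency users -/
  buf : L → Finset ℕ
  /-- slot in which a packet of a latency user was received, if it has been received -/
  rcv : L → ℕ → Option ℕ
  /-- number of transmission attempts -/
  att : UE A L R → ℕ
  /-- number of received packets -/
  recv : UE A L R → ℕ

def State.init : State A L R where
  a _ := 0
  b _ := 0
  W _ := 0
  latest _ := 0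
  lam _ := 0
  buf _ := ∅
  rcv _ _ := none
  att _ := 0
  recv _ := 0

/-- The counter of `i` is incremented in slot `t`: a packet arrives, and the latest increment was
more than `⌈T̄_i^⋆ - 1 / q_i⌉` slots ago. -/
def increments (P : Params A L R) (T : A → ℝ) (t : ℕ) (s : State A L R) (z : Input A L R)
    (i : A) : Prop :=
  z.arrA i = true ∧ ⌈T i - 1 / P.qA i⌉ < (t : ℤ) - (s.a i : ℤ)

open Classical in
/-- Step 1: arrivals of slot `t`, and update of the indices of the AoI users. -/
def arrivals (P : Params A L R) (T : A → ℝ) (t : ℕ) (s : State A L R) (z : Input A L R) :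
    State A L R :=
  let b' : A → ℕ := fun i => if increments P T t s z i then s.b i + 1 else s.b i
  { s with
    a := fun i => if increments P T t s z i then t else s.a i
    b := b'
    W := fun i =>
      if z.arrA i = true ∧ s.recv (.aoi i) < b' i
      then P.ρ i * P.p (.aoi i) * ((t : ℝ) - s.lam i) else s.W i
    latest := fun i => if z.arrA i then t else s.latest i
    buf := fun j => if z.arrL j then insert t (s.buf j) else s.buf j }

/-- Index `α_k t / p_k - R̂_k(t)` of a throughput user. -/
def Y (P : Params A L R) (t : ℕ) (s : State A L R) (k : R) : ℝ :=
  P.α k * t / P.p (.thr k) - s.att (.thr k)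

open Classical in
/-- Step 2: the users that may be taken as `ℓ⋆`. -/
def candidates (P : Params A L R) (t : ℕ) (s : State A L R) : Finset (UE A L R) :=
  if ∃ i, 0 < s.W i then
    Finset.univ.filter fun u => ∃ i, u = .aoi i ∧ ∀ i', s.W i' ≤ s.W i
  else
    Finset.univ.filter fun u => ∃ k, u = .thr k ∧ ∀ k', Y P t s k' ≤ Y P t s k

/-- A rule that breaks the ties of the maximisations in step 2. It may depend on the slot and on
everything the base station keeps track of. -/
abbrev TieRule (A L R : Type*) := ℕ → State A L R → Finset (UE A L R) → UE A L R

/-- A tie-breaking rule chooses one of the proposed users. -/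
def IsTieRule (tie : TieRule A L R) : Prop :=
  ∀ t s (F : Finset (UE A L R)), F.Nonempty → tie t s F ∈ F

/-- Step 2: the user `ℓ⋆` (there is none if there are neither throughput users nor AoI users with a
positive index). -/
def bestUE (P : Params A L R) (tie : TieRule A L R) (t : ℕ) (s : State A L R) :
    Option (UE A L R) :=
  if (candidates P t s).Nonempty then some (tie t s (candidates P t s)) else none

/-- The latency users with a stored packet. -/
def backlogged (s : State A L R) : Finset L :=
  Finset.univ.filter fun j => (s.buf j).Nonempty

/-- Step 3: the user that is served. -/
def served (P : Params A L R) (tie : TieRule A L R) (t : ℕ) (s : State A L R)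
    (z : Input A L R) : Option (UE A L R) :=
  match pick (backlogged s) z.token with
  | some j => some (.lat j)
  | none => bestUE P tie t s

/-- Bookkeeping after the latest packet of the user `u` has been received in slot `t`. -/
def deliver (t : ℕ) (s : State A L R) : UE A L R → State A L R
  | .aoi i =>
    { s with
      W := Function.update s.W i 0
      lam := Function.update s.lam i (s.latest i)
      recv := Function.update s.recv (.aoi i) (s.recv (.aoi i) + 1) }
  | .lat j =>
    let g : ℕ := (s.buf j).sup id
    { s with
      buf := Function.update s.buf j ((s.buf j).erase g)
      rcv := Function.update s.rcv j (Function.update (s.rcv j) g (some t))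
      recv := Function.update s.recv (.lat j) (s.recv (.lat j) + 1) }
  | .thr k =>
    { s with recv := Function.update s.recv (.thr k) (s.recv (.thr k) + 1) }

/-- Transmission of the latest packet of the user `u` in slot `t`. -/
def transmit (t : ℕ) (s : State A L R) (z : Input A L R) (u : UE A L R) : State A L R :=
  let s' : State A L R := { s with att := Function.update s.att u (s.att u + 1) }
  if z.chan u then deliver t s' u else s'

/-- One slot of the randomised hierarchical index policy. -/
def step (P : Params A L R) (T : A → ℝ) (tie : TieRule A L R) (t : ℕ) (s : State A L R)
    (z : Input A L R) : State A L R :=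
  let s₁ := arrivals P T t s z
  match served P tie t s₁ z with
  | some u => transmit t s₁ z u
  | none => s₁

/-- State at the end of slot `t`, when the policy is run on the inputs `z 1, z 2, …`. -/
def run (P : Params A L R) (T : A → ℝ) (tie : TieRule A L R) (z : ℕ → Input A L R) :
    ℕ → State A L R
  | 0 => State.init
  | t + 1 => step P T tie (t + 1) (run P T tie z t) (z (t + 1))

/-! ### Quality of service -/

/-- Slots `1, …, t` in which a packet arrives for the latency user `j`. -/
def arrived (z : ℕ → Input A L R) (j : L) (t : ℕ) : Finset ℕ :=
  (Finset.Icc 1 t).filter fun g => (z g).arrL j = true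

/-- Average latency of the latency user `j` until slot `t`; a packet that has not been received
counts as if it were received in slot `t`. -/
def avgLatency (P : Params A L R) (T : A → ℝ) (tie : TieRule A L R) (z : ℕ → Input A L R)
    (j : L) (t : ℕ) : ℝ :=
  (∑ g ∈ arrived z j t,
      (((((run P T tie z t).rcv j g).getD t : ℕ) : ℝ) - (g : ℝ) + 1)) /
    ((arrived z j t).card : ℝ)

/-- Number of packets received per slot by the user `u` until slot `t`. -/
def rate (P : Params A L R) (T : A → ℝ) (tie : TieRule A L R) (z : ℕ → Input A L R)
    (u : UE A L R) (t : ℕ) : ℝ :=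
  ((run P T tie z t).recv u : ℝ) / (t : ℝ)

/-- The user `u` has throughput `r`. -/
def HasThroughput (P : Params A L R) (T : A → ℝ) (tie : TieRule A L R) (z : ℕ → Input A L R)
    (u : UE A L R) (r : ℝ) : Prop :=
  Tendsto (rate P T tie z u) atTop (𝓝 r)

end RDScheduling

end

/-!
The state of the policy at the end of slot `n` is a function of the inputs of the slots up to `n`,
and the inputs are independent and take finitely many values. So all limits are obtained from one
law of large numbers for increments that are centred given the past: such increments are
orthogonal, hence their sums over `n` slots are `o(n)` along the squares
(`ae_tendsto_sum_div_sq`), and monotonicity fills the gaps.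

*Latency.* A latency user `j` is a queue with the Lindley recursion `Q' = (Q + a) - s`
(`queue_succ`), whose arrivals `a` and services `s` are independent Bernoulli variables with
parameters `q_j` and `θ_j p_j`. The latencies add up to the sum over the slots of `Q + a`
(`sum_latency`). The increments of `Q (Q + 1) / 2` are `Q (a - s) + a (1 - s)`, so the law of large
numbers gives the time average of `Q`, once the second moment of `Q` is known to be bounded, for
which an exponential Lyapunov function is used (`exists_integral_queue_le`). By the choice of `θ_j`
the resulting average latency is `β_j` if `q_j < 1`. If `q_j = 1`, then `θ_j p_j = 1` and every
packet is received at once.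

*Throughput.* The receptions of an AoI user are bounded by its counter `b_i`. Between two
increments of `b_i` there are `⌈T_i - 1 / q_i⌉` slots (none if this is negative) and then a geometric
time with mean `1 / q_i`, at least `T_i` slots on average; so in the long run the user takes at most
`1 / (p_i T_i)` attempts per slot (`ae_rate_aoi_le`). The latency users take `q_j / p_j` attempts
per slot. Since no slot is idle and `T` is feasible, the throughput users get at
least `∑ α_k / p_k` attempts per slot: the sum of their indices `α_k t / p_k - R̂_k(t)` is at most
`o(t)`. As only a largest index is ever decreased, no index can stay above `ε t`
(`frequently_index_le`); and if the sum of the indices is asymptotically `-σ t`, then each of them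
is asymptotically its equal share of it, because an index that has just been decreased is not far
below the average, and grows until it is decreased again (`tendsto_index_div`).
-/

open MeasureTheory ProbabilityTheory Filter Topology

namespace RDScheduling

set_option linter.unusedSectionVars false

/-! ### Functionals of a finite-valued independent sequence -/

section Independent

variable {X : Type*} [MeasurableSpace X] [Fintype X] [MeasurableSingletonClass X]
  {Ω : Type*} [MeasurableSpace Ω] {μ : Measure Ω} {Z : ℕ → Ω → X} {w : X → ℝ}

theorem measurable_of_dependsOn (hm : ∀ t, Measurable (Z t)) {n : ℕ} {F : (ℕ → X) → ℝ}
    (hF : DependsOn F (Finset.Iic n : Set ℕ)) : Measurable fun ω => F (fun t => Z t ω) := by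
  obtain ⟨g, rfl⟩ := dependsOn_iff_exists_comp.1 hF
  have hg : Measurable g := measurable_of_countable g
  exact hg.comp (measurable_pi_lambda _ fun i => hm i)

theorem integrable_of_dependsOn [IsFiniteMeasure μ] (hm : ∀ t, Measurable (Z t)) {n : ℕ}
    {F : (ℕ → X) → ℝ} (hF : DependsOn F (Finset.Iic n : Set ℕ)) :
    Integrable (fun ω => F (fun t => Z t ω)) μ := by
  have hmeas := measurable_of_dependsOn (Z := Z) hm hF
  obtain ⟨g, rfl⟩ := dependsOn_iff_exists_comp.1 hF
  obtain ⟨C, hC⟩ := Finite.exists_le fun y => ‖g y‖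
  exact Integrable.of_bound hmeas.aestronglyMeasurable C (ae_of_all _ fun ω => hC _)

theorem dependsOn_succ {n : ℕ} {G : (ℕ → X) → X → ℝ}
    (hG : DependsOn G (Finset.Iic n : Set ℕ)) :
    DependsOn (fun z => G z (z (n + 1))) (Finset.Iic (n + 1) : Set ℕ) := by
  intro z z' h
  have h1 : G z = G z' := hG fun i hi => h i (by simp at hi ⊢; omega)
  have h2 : z (n + 1) = z' (n + 1) := h _ (by simp)
  simp only [h1, h2]

/-- Expectation over the fresh value `Z (n + 1)`, the values up to time `n` being kept. -/
theorem integral_fresh [IsProbabilityMeasure μ] (hm : ∀ t, Measurable (Z t)) (hi : iIndepFun Z μ)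
    (hw : ∀ t x, μ.real {ω | Z t ω = x} = w x) {n : ℕ} {G : (ℕ → X) → X → ℝ}
    (hG : DependsOn G (Finset.Iic n : Set ℕ)) :
    ∫ ω, G (fun t => Z t ω) (Z (n + 1) ω) ∂μ = ∫ ω, ∑ x, w x * G (fun t => Z t ω) x ∂μ := by
  classical
  have hGx : ∀ x, DependsOn (fun z => G z x) (Finset.Iic n : Set ℕ) := fun x z z' h =>
    congrFun (hG h) x
  have key : ∀ x, ∫ ω, G (fun t => Z t ω) x * (if Z (n + 1) ω = x then 1 else 0) ∂μ =
      w x * ∫ ω, G (fun t => Z t ω) x ∂μ := by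
    intro x
    have hind : IndepFun (fun ω => G (fun t => Z t ω) x)
        (fun ω => if Z (n + 1) ω = x then (1 : ℝ) else 0) μ := by
      obtain ⟨g, hg⟩ := dependsOn_iff_exists_comp.1 (hGx x)
      have h := hi.indepFun_finset (Finset.Iic n) {n + 1} (by simp) hm
      have h' := h.comp (φ := g)
        (ψ := fun y => if y ⟨n + 1, by simp⟩ = x then (1 : ℝ) else 0)
        (measurable_of_countable _) (measurable_of_countable _)
      have h1 : (fun ω => G (fun t => Z t ω) x) =
          g ∘ fun ω (i : (Finset.Iic n : Finset ℕ)) => Z i ω := by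
        ext ω
        exact congrFun hg _
      rw [h1]
      exact h'
    have hmx : Measurable fun ω => if Z (n + 1) ω = x then (1 : ℝ) else 0 :=
      Measurable.ite (hm (n + 1) (measurableSet_singleton x)) measurable_const measurable_const
    rw [hind.integral_fun_mul_eq_mul_integral
      (measurable_of_dependsOn hm (hGx x)).aestronglyMeasurable hmx.aestronglyMeasurable, mul_comm]
    congr 1
    rw [← hw (n + 1) x, ← integral_indicator_one (s := {ω | Z (n + 1) ω = x})
      (hm (n + 1) (measurableSet_singleton x))]
    refine integral_congr_ae (ae_of_all _ fun ω => ?_)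
    simp [Set.indicator]
  have hint : ∀ x, Integrable
      (fun ω => G (fun t => Z t ω) x * (if Z (n + 1) ω = x then 1 else 0)) μ := fun x =>
    integrable_of_dependsOn (n := n + 1) hm
      (F := fun z => G z x * (if z (n + 1) = x then 1 else 0))
      (dependsOn_succ (G := fun z y => G z x * (if y = x then 1 else 0)) fun z z' h => by
        ext y; simp only [hG h])
  calc ∫ ω, G (fun t => Z t ω) (Z (n + 1) ω) ∂μ
      = ∫ ω, ∑ x, G (fun t => Z t ω) x * (if Z (n + 1) ω = x then 1 else 0) ∂μ := by
        refine integral_congr_ae (ae_of_all _ fun ω => ?_)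
        simp
    _ = ∑ x, w x * ∫ ω, G (fun t => Z t ω) x ∂μ := by
        rw [integral_finsetSum _ fun x _ => hint x]
        exact Finset.sum_congr rfl fun x _ => key x
    _ = ∫ ω, ∑ x, w x * G (fun t => Z t ω) x ∂μ := by
        rw [integral_finsetSum _ fun x _ => (integrable_of_dependsOn hm (hGx x)).const_mul _]
        exact Finset.sum_congr rfl fun x _ => (integral_const_mul _ _).symm

theorem dependsOn_sum_increments {D : ℕ → (ℕ → X) → X → ℝ}
    (hD : ∀ n, DependsOn (D n) (Finset.Iic n : Set ℕ)) (n : ℕ) :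
    DependsOn (fun z => ∑ i ∈ Finset.range n, D i z (z (i + 1))) (Finset.Iic n : Set ℕ) := by
  intro z z' h
  refine Finset.sum_congr rfl fun i hi => dependsOn_succ (hD i) fun m hm => h m ?_
  simp at hi hm ⊢
  omega

/-- Increments that are centred given the past are orthogonal. -/
theorem integral_sq_sum_le [IsProbabilityMeasure μ] (hm : ∀ t, Measurable (Z t))
    (hi : iIndepFun Z μ) (hw : ∀ t x, μ.real {ω | Z t ω = x} = w x) {D : ℕ → (ℕ → X) → X → ℝ}
    (hD : ∀ n, DependsOn (D n) (Finset.Iic n : Set ℕ))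
    (hzero : ∀ n z, ∑ x, w x * D n z x = 0) {C : ℝ}
    (hC : ∀ n, ∫ ω, D n (fun t => Z t ω) (Z (n + 1) ω) ^ 2 ∂μ ≤ C) (n : ℕ) :
    ∫ ω, (∑ i ∈ Finset.range n, D i (fun t => Z t ω) (Z (i + 1) ω)) ^ 2 ∂μ ≤ n * C := by
  induction n with
  | zero => simp
  | succ n ih =>
    have hS := dependsOn_sum_increments hD n
    set S : (ℕ → X) → ℝ := fun z => ∑ i ∈ Finset.range n, D i z (z (i + 1))
    have hSD : DependsOn (fun z x => S z * D n z x) (Finset.Iic n : Set ℕ) := fun z z' h => by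
      have := hS h
      ext x
      simp only [S] at this ⊢
      rw [this, hD n h]
    have hcross : ∫ ω, S (fun t => Z t ω) * D n (fun t => Z t ω) (Z (n + 1) ω) ∂μ = 0 := by
      rw [integral_fresh hm hi hw hSD]
      have : ∀ z, ∑ x, w x * (S z * D n z x) = 0 := fun z => by
        rw [← mul_zero (S z), ← hzero n z, Finset.mul_sum]
        exact Finset.sum_congr rfl fun x _ => by ring
      simp [this]
    have i1 : Integrable (fun ω => S (fun t => Z t ω) ^ 2) μ :=
      integrable_of_dependsOn hm (F := fun z => S z ^ 2) fun z z' h => by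
        have := hS h
        simp only [S] at this ⊢
        rw [this]
    have i2 : Integrable
        (fun ω => S (fun t => Z t ω) * D n (fun t => Z t ω) (Z (n + 1) ω)) μ :=
      integrable_of_dependsOn hm (dependsOn_succ hSD)
    have i12 : Integrable (fun ω => S (fun t => Z t ω) ^ 2 +
        2 * (S (fun t => Z t ω) * D n (fun t => Z t ω) (Z (n + 1) ω))) μ :=
      i1.add (i2.const_mul 2)
    have i3 : Integrable (fun ω => D n (fun t => Z t ω) (Z (n + 1) ω) ^ 2) μ :=
      integrable_of_dependsOn hm
      (dependsOn_succ (G := fun z x => D n z x ^ 2) fun z z' h => by ext x; simp only [hD n h])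
    calc ∫ ω, (∑ i ∈ Finset.range (n + 1), D i (fun t => Z t ω) (Z (i + 1) ω)) ^ 2 ∂μ
        = ∫ ω, ((S (fun t => Z t ω) ^ 2 +
            2 * (S (fun t => Z t ω) * D n (fun t => Z t ω) (Z (n + 1) ω))) +
            D n (fun t => Z t ω) (Z (n + 1) ω) ^ 2) ∂μ := by
          refine integral_congr_ae (ae_of_all _ fun ω => ?_)
          simp only [Finset.sum_range_succ, S]
          ring
      _ ≤ n * C + C := by
          rw [integral_add i12 i3, integral_add i1 (i2.const_mul 2),
            integral_const_mul, hcross]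
          linarith [hC n]
      _ = (n + 1 : ℕ) * C := by push_cast; ring

/-- Nonnegative variables with means `O(1 / k²)` tend to `0`. -/
theorem ae_tendsto_zero_of_integral_le {Y : ℕ → Ω → ℝ} (hY : ∀ k ω, 0 ≤ Y k ω)
    (hint : ∀ k, Integrable (Y k) μ) {C : ℝ} (hC : ∀ k, ∫ ω, Y k ω ∂μ ≤ C / (k : ℝ) ^ 2) :
    ∀ᵐ ω ∂μ, Tendsto (fun k => Y k ω) atTop (𝓝 0) := by
  have hsum : Summable fun k : ℕ => C / (k : ℝ) ^ 2 := by
    simpa [div_eq_mul_inv] using (Real.summable_nat_pow_inv.2 one_lt_two).mul_left C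
  have hfin : ∫⁻ ω, ∑' k, ENNReal.ofReal (Y k ω) ∂μ ≠ ⊤ := by
    rw [lintegral_tsum fun k => (hint k).aestronglyMeasurable.aemeasurable.ennreal_ofReal]
    have : ∀ k, ∫⁻ ω, ENNReal.ofReal (Y k ω) ∂μ = ENNReal.ofReal (∫ ω, Y k ω ∂μ) := fun k =>
      (ofReal_integral_eq_lintegral_ofReal (hint k) (ae_of_all _ (hY k))).symm
    simp_rw [this]
    refine ne_top_of_le_ne_top hsum.tsum_ofReal_ne_top ?_
    exact ENNReal.tsum_le_tsum fun k => ENNReal.ofReal_le_ofReal (hC k)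
  have hae := ae_lt_top' (AEMeasurable.tsum
    fun k => (hint k).aestronglyMeasurable.aemeasurable.ennreal_ofReal) hfin
  filter_upwards [hae] with ω hω
  have h := ENNReal.tendsto_atTop_zero_of_tsum_ne_top hω.ne
  have h' := (ENNReal.tendsto_toReal ENNReal.zero_ne_top).comp h
  simpa [Function.comp_def, ENNReal.toReal_ofReal (hY _ ω)] using h'

/-- Law of large numbers for centred increments with bounded second moments, along the squares. -/
theorem ae_tendsto_sum_div_sq [IsProbabilityMeasure μ] (hm : ∀ t, Measurable (Z t))
    (hi : iIndepFun Z μ) (hw : ∀ t x, μ.real {ω | Z t ω = x} = w x) {D : ℕ → (ℕ → X) → X → ℝ}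
    (hD : ∀ n, DependsOn (D n) (Finset.Iic n : Set ℕ))
    (hzero : ∀ n z, ∑ x, w x * D n z x = 0) {C : ℝ}
    (hC : ∀ n, ∫ ω, D n (fun t => Z t ω) (Z (n + 1) ω) ^ 2 ∂μ ≤ C) :
    ∀ᵐ ω ∂μ, Tendsto (fun k : ℕ =>
      (∑ i ∈ Finset.range (k ^ 2), D i (fun t => Z t ω) (Z (i + 1) ω)) / ((k ^ 2 : ℕ) : ℝ))
      atTop (𝓝 0) := by
  have hS := fun n => dependsOn_sum_increments hD n
  have h := ae_tendsto_zero_of_integral_le (μ := μ) (C := C)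
    (Y := fun k ω => ((∑ i ∈ Finset.range (k ^ 2), D i (fun t => Z t ω) (Z (i + 1) ω)) /
      ((k ^ 2 : ℕ) : ℝ)) ^ 2) (fun k ω => sq_nonneg _)
    (fun k => integrable_of_dependsOn hm (n := k ^ 2)
      (F := fun z => ((∑ i ∈ Finset.range (k ^ 2), D i z (z (i + 1))) / ((k ^ 2 : ℕ) : ℝ)) ^ 2)
      fun z z' h => by have := hS _ h; simp only at this ⊢; rw [this])
    (fun k => by
      simp only [div_pow]
      rw [integral_div]
      rcases Nat.eq_zero_or_pos k with rfl | hk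
      · simp
      · have hk' : (0 : ℝ) < k := by exact_mod_cast hk
        rw [div_le_div_iff₀ (by positivity) (by positivity)]
        have := integral_sq_sum_le hm hi hw hD hzero hC (k ^ 2)
        push_cast at this ⊢
        nlinarith [mul_le_mul_of_nonneg_right this (sq_nonneg (k : ℝ))])
  filter_upwards [h] with ω hω
  have := hω.sqrt
  simp only [Real.sqrt_sq_eq_abs, Real.sqrt_zero] at this
  exact (tendsto_zero_iff_abs_tendsto_zero _).2 this

/-- For monotone sequences, convergence of the averages along the squares is enough. -/
theorem tendsto_div_of_monotone_of_sq {u : ℕ → ℝ} {l : ℝ} (hu : Monotone u)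
    (h : Tendsto (fun k : ℕ => u (k ^ 2) / ((k ^ 2 : ℕ) : ℝ)) atTop (𝓝 l)) :
    Tendsto (fun n => u n / n) atTop (𝓝 l) := by
  refine tendsto_div_of_monotone_of_exists_subseq_tendsto_div u l hu fun a ha =>
    ⟨fun k => k ^ 2, ?_, tendsto_pow_atTop two_ne_zero, h⟩
  obtain ⟨N, hN⟩ := exists_nat_gt (3 / (a - 1))
  filter_upwards [eventually_ge_atTop (max N 1)] with k hk
  have h1 : (1 : ℝ) ≤ k := by exact_mod_cast (le_max_right _ _).trans hk
  have h2 : (N : ℝ) ≤ k := by exact_mod_cast (le_max_left _ _).trans hk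
  have h3 : 3 ≤ (a - 1) * k := by
    rw [div_lt_iff₀ (by linarith)] at hN
    nlinarith
  push_cast
  nlinarith

/-- Law of large numbers for bounded centred increments. -/
theorem ae_tendsto_sum_div [IsProbabilityMeasure μ] (hm : ∀ t, Measurable (Z t))
    (hi : iIndepFun Z μ) (hw : ∀ t x, μ.real {ω | Z t ω = x} = w x) {D : ℕ → (ℕ → X) → X → ℝ}
    (hD : ∀ n, DependsOn (D n) (Finset.Iic n : Set ℕ))
    (hzero : ∀ n z, ∑ x, w x * D n z x = 0) {K : ℝ} (hK : ∀ n z x, |D n z x| ≤ K) :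
    ∀ᵐ ω ∂μ, Tendsto (fun n : ℕ =>
      (∑ i ∈ Finset.range n, D i (fun t => Z t ω) (Z (i + 1) ω)) / (n : ℝ)) atTop (𝓝 0) := by
  have h := ae_tendsto_sum_div_sq hm hi hw hD hzero (C := K ^ 2) fun n => by
    have : ∫ ω, D n (fun t => Z t ω) (Z (n + 1) ω) ^ 2 ∂μ ≤ ∫ _, K ^ 2 ∂μ := by
      refine integral_mono_of_nonneg (ae_of_all _ fun ω => sq_nonneg _) (integrable_const _)
        (ae_of_all _ fun ω => ?_)
      exact sq_le_sq' (abs_le.1 (hK _ _ _)).1 (abs_le.1 (hK _ _ _)).2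
    simpa using this
  filter_upwards [h] with ω hω
  -- adding the constant `K` to all increments makes the partial sums monotone
  have hmono : Monotone fun n : ℕ =>
      ∑ i ∈ Finset.range n, (D i (fun t => Z t ω) (Z (i + 1) ω) + K) :=
    monotone_nat_of_le_succ fun n => by
      rw [Finset.sum_range_succ]
      linarith [(abs_le.1 (hK n (fun t => Z t ω) (Z (n + 1) ω))).1]
  have hsplit : ∀ n : ℕ, ∑ i ∈ Finset.range n, (D i (fun t => Z t ω) (Z (i + 1) ω) + K) =
      ∑ i ∈ Finset.range n, D i (fun t => Z t ω) (Z (i + 1) ω) + n * K := fun n => by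
    simp [Finset.sum_add_distrib]
  have h2 := tendsto_div_of_monotone_of_sq (l := K) hmono (by
    have := hω.add_const K
    rw [zero_add] at this
    refine this.congr' ?_
    filter_upwards [eventually_gt_atTop 0] with k hk
    have : ((k ^ 2 : ℕ) : ℝ) ≠ 0 := by positivity
    rw [hsplit]
    field_simp)
  have h3 := h2.sub_const K
  rw [sub_self] at h3
  refine h3.congr' ?_
  filter_upwards [eventually_gt_atTop 0] with n hn
  have : (n : ℝ) ≠ 0 := by positivity
  rw [hsplit]
  field_simp
  ring

end Independent

variable {A L R : Type*} [Fintype A] [Fintype L] [Fintype R]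
  [DecidableEq A] [DecidableEq L] [DecidableEq R]

/-! ### The law of one slot -/

/-- The randomness of a slot as a tuple of its components. -/
def inputEquiv : Input A L R ≃ (A → Bool) × (L → Bool) × (UE A L R → Bool) × Option L where
  toFun x := (x.arrA, x.arrL, x.chan, x.token)
  invFun y := ⟨y.1, y.2.1, y.2.2.1, y.2.2.2⟩
  left_inv _ := rfl
  right_inv _ := rfl

instance : Fintype (Input A L R) := Fintype.ofEquiv _ inputEquiv.symm

instance : MeasurableSingletonClass (Input A L R) := ⟨fun _ => trivial⟩

theorem sum_input (f : Input A L R → ℝ) :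
    ∑ x, f x = ∑ a, ∑ l, ∑ c, ∑ k, f ⟨a, l, c, k⟩ := by
  rw [← inputEquiv.symm.sum_comp f]
  simp only [Fintype.sum_prod_type]
  rfl

/-- Marginal law of one coordinate of a family of independent Bernoulli variables. -/
theorem sum_prod_bern_mul {ι : Type*} [Fintype ι] [DecidableEq ι] (x : ι → ℝ) (i₀ : ι)
    (g : Bool → ℝ) :
    ∑ c : ι → Bool, (∏ i, bern (x i) (c i)) * g (c i₀) = ∑ b, bern (x i₀) b * g b := by
  have h : ∀ c : ι → Bool, (∏ i, bern (x i) (c i)) * g (c i₀) =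
      ∏ i, (bern (x i) (c i) * if i = i₀ then g (c i) else 1) := fun c => by
    rw [Finset.prod_mul_distrib]
    simp
  simp_rw [h]
  rw [← Fintype.prod_sum (fun i b => bern (x i) b * if i = i₀ then g b else 1),
    ← Finset.mul_prod_erase _ _ (Finset.mem_univ i₀), Finset.prod_eq_one, mul_one]
  · simp
  · intro i hi
    simp [Finset.ne_of_mem_erase hi, bern]

theorem sum_prod_bern {ι : Type*} [Fintype ι] [DecidableEq ι] (x : ι → ℝ) :
    ∑ c : ι → Bool, ∏ i, bern (x i) (c i) = 1 := by
  rw [← Fintype.prod_sum (fun i b => bern (x i) b)]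
  simp [bern]

theorem sum_tokenProb (P : Params A L R) : ∑ k, P.tokenProb k = 1 := by
  simp [Fintype.sum_option, Params.tokenProb]

/-- A function of all components of a slot but the channels is independent of a channel. -/
theorem sum_inputProb_chan (P : Params A L R) (u : UE A L R) (F : Input A L R → ℝ)
    (hF : ∀ x c, F { x with chan := c } = F x) :
    ∑ x, P.inputProb x * (F x * ((if x.chan u then 1 else 0) - P.p u)) = 0 := by
  rw [sum_input]
  refine Finset.sum_eq_zero fun a _ => Finset.sum_eq_zero fun l _ => ?_
  rw [Finset.sum_comm]
  refine Finset.sum_eq_zero fun k _ => ?_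
  have h := sum_prod_bern_mul P.p u fun b => (if b then 1 else 0) - P.p u
  rw [Fintype.sum_bool] at h
  have h0 : bern (P.p u) true * ((if (true : Bool) then 1 else 0) - P.p u) +
      bern (P.p u) false * ((if (false : Bool) then 1 else 0) - P.p u) = 0 := by
    simp [bern]
    ring
  rw [h0] at h
  have hFc : ∀ c, F ⟨a, l, c, k⟩ = F ⟨a, l, fun _ => true, k⟩ := fun c =>
    (hF ⟨a, l, c, k⟩ fun _ => true).symm
  calc ∑ c : UE A L R → Bool, P.inputProb ⟨a, l, c, k⟩ * (F ⟨a, l, c, k⟩ * ((if c u then 1 else 0) - P.p u))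
      = ∑ c : UE A L R → Bool, ((∏ i, bern (P.qA i) (a i)) * (∏ j, bern (P.qL j) (l j)) * P.tokenProb k *
          F ⟨a, l, fun _ => true, k⟩) *
          ((∏ u, bern (P.p u) (c u)) * ((if c u then 1 else 0) - P.p u)) := by
        refine Finset.sum_congr rfl fun c _ => ?_
        rw [hFc c]
        simp only [Params.inputProb]
        ring
    _ = 0 := by rw [← Finset.mul_sum, h, mul_zero]

/-- Marginal law of an arrival for an AoI user. -/
theorem sum_inputProb_arrA (P : Params A L R) (i : A) (g : Bool → ℝ) :
    ∑ x, P.inputProb x * g (x.arrA i) = ∑ b, bern (P.qA i) b * g b := by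
  rw [sum_input, ← sum_prod_bern_mul P.qA i g]
  refine Finset.sum_congr rfl fun a _ => ?_
  simp only [Params.inputProb]
  have : ∀ (l : L → Bool) (c : UE A L R → Bool) (k : Option L), (∏ i, bern (P.qA i) (a i)) * (∏ j, bern (P.qL j) (l j)) *
      (∏ u, bern (P.p u) (c u)) * P.tokenProb k * g (a i) =
      ((∏ i, bern (P.qA i) (a i)) * g (a i)) * ((∏ j, bern (P.qL j) (l j)) *
        ((∏ u, bern (P.p u) (c u)) * P.tokenProb k)) := fun l c k => by ring
  simp_rw [this, ← Finset.mul_sum, sum_tokenProb, mul_one, sum_prod_bern, mul_one, sum_prod_bern,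
    mul_one]

/-- A transmission to the latency user `j` would be successful, if `j` had a packet. -/
def svc (j : L) (x : Input A L R) : Bool := decide (x.token = some j) && x.chan (.lat j)

/-- Probability of `svc j`. -/
noncomputable def Params.svcRate (P : Params A L R) (j : L) : ℝ := P.θ j * P.p (.lat j)

/-- Joint law of arrival and service of a latency user. -/
theorem sum_inputProb_lat (P : Params A L R) (j : L) (g : Bool → Bool → ℝ) :
    ∑ x, P.inputProb x * g (x.arrL j) (svc j x) =
      ∑ a, ∑ s, bern (P.qL j) a * (bern (P.svcRate j) s * g a s) := by
  have hs : ∀ b, ∑ c : UE A L R → Bool, ∑ k, (∏ u, bern (P.p u) (c u)) * P.tokenProb k *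
      g b (decide (k = some j) && c (.lat j)) =
      ∑ s, bern (P.svcRate j) s * g b s := by
    intro b
    rw [Finset.sum_comm]
    have h1 : ∀ k : Option L, ∑ c : UE A L R → Bool, (∏ u, bern (P.p u) (c u)) * P.tokenProb k *
        g b (decide (k = some j) && c (.lat j)) = P.tokenProb k *
          ∑ v, bern (P.p (.lat j)) v * g b (decide (k = some j) && v) := fun k => by
      rw [← sum_prod_bern_mul P.p (.lat j) fun v => g b (decide (k = some j) && v),
        Finset.mul_sum]
      exact Finset.sum_congr rfl fun c _ => by ring
    have h2 : ∀ k : Option L, P.tokenProb k *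
          ∑ v, bern (P.p (.lat j)) v * g b (decide (k = some j) && v) =
        P.tokenProb k * g b false + if k = some j then P.tokenProb (some j) *
          (P.p (.lat j) * (g b true - g b false)) else 0 := fun k => by
      by_cases hk : k = some j
      · subst hk
        simp [bern]
        ring
      · simp only [bern, hk, Fintype.sum_bool]
        simp
        left
        ring
    rw [Finset.sum_congr rfl fun k _ => (h1 k).trans (h2 k), Finset.sum_add_distrib,
      ← Finset.sum_mul, sum_tokenProb]
    simp [bern, Params.svcRate, Params.tokenProb]
    ring
  rw [sum_input]
  have h3 : ∀ (a : A → Bool) (l : L → Bool), (∑ c, ∑ k, P.inputProb ⟨a, l, c, k⟩ *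
      g (l j) (svc j ⟨a, l, c, k⟩)) = (∏ i, bern (P.qA i) (a i)) *
        ((∏ j, bern (P.qL j) (l j)) * ∑ s, bern (P.svcRate j) s * g (l j) s) := fun a l => by
    rw [← hs, Finset.mul_sum, Finset.mul_sum]
    refine Finset.sum_congr rfl fun c _ => ?_
    rw [Finset.mul_sum, Finset.mul_sum]
    refine Finset.sum_congr rfl fun k _ => ?_
    simp only [Params.inputProb, svc]
    ring
  simp_rw [h3, ← Finset.mul_sum]
  rw [← Finset.sum_mul, sum_prod_bern, one_mul,
    sum_prod_bern_mul P.qL j fun b => ∑ s, bern (P.svcRate j) s * g b s]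

/-! ### One slot of the policy -/

section Step

theorem transmit_att (t : ℕ) (s : State A L R) (z : Input A L R) (v u : UE A L R) :
    (transmit t s z v).att u = s.att u + if v = u then 1 else 0 := by
  unfold transmit
  by_cases hc : z.chan v <;> rcases v with i | j | k <;>
    simp [hc, deliver, Function.update_apply] <;> grind

theorem transmit_recv (t : ℕ) (s : State A L R) (z : Input A L R) (v u : UE A L R) :
    (transmit t s z v).recv u = s.recv u + if v = u ∧ z.chan u = true then 1 else 0 := by
  unfold transmit
  by_cases hc : z.chan v <;> rcases v with i | j | k <;>
    simp [hc, deliver, Function.update_apply] <;> grind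

theorem transmit_a (t : ℕ) (s : State A L R) (z : Input A L R) (v : UE A L R) :
    (transmit t s z v).a = s.a := by
  unfold transmit
  by_cases hc : z.chan v <;> rcases v with i | j | k <;> simp [hc, deliver]

theorem transmit_b (t : ℕ) (s : State A L R) (z : Input A L R) (v : UE A L R) :
    (transmit t s z v).b = s.b := by
  unfold transmit
  by_cases hc : z.chan v <;> rcases v with i | j | k <;> simp [hc, deliver]

theorem transmit_W (t : ℕ) (s : State A L R) (z : Input A L R) (v : UE A L R) (i : A) :
    (transmit t s z v).W i = if v = .aoi i ∧ z.chan (.aoi i) = true then 0 else s.W i := by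
  unfold transmit
  by_cases hc : z.chan v <;> rcases v with i' | j | k <;>
    simp [hc, deliver, Function.update_apply] <;> grind

theorem transmit_buf (t : ℕ) (s : State A L R) (z : Input A L R) (v : UE A L R) (j : L) :
    (transmit t s z v).buf j = if v = .lat j ∧ z.chan (.lat j) = true
      then (s.buf j).erase ((s.buf j).sup id) else s.buf j := by
  unfold transmit
  by_cases hc : z.chan v <;> rcases v with i' | j' | k <;>
    simp [hc, deliver, Function.update_apply] <;> grind

theorem transmit_rcv (t : ℕ) (s : State A L R) (z : Input A L R) (v : UE A L R) (j : L) :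
    (transmit t s z v).rcv j = if v = .lat j ∧ z.chan (.lat j) = true
      then Function.update (s.rcv j) ((s.buf j).sup id) (some t) else s.rcv j := by
  unfold transmit
  by_cases hc : z.chan v <;> rcases v with i' | j' | k <;>
    simp [hc, deliver, Function.update_apply] <;> grind

variable (P : Params A L R) (T : A → ℝ) (tie : TieRule A L R) (t : ℕ) (s : State A L R)
  (z : Input A L R)

theorem step_of_none (h : served P tie t (arrivals P T t s z) z = none) :
    step P T tie t s z = arrivals P T t s z := by
  simp only [step, h]

theorem step_of_some {u : UE A L R} (h : served P tie t (arrivals P T t s z) z = some u) :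
    step P T tie t s z = transmit t (arrivals P T t s z) z u := by
  simp only [step, h]

theorem step_att (u : UE A L R) :
    (step P T tie t s z).att u =
      s.att u + if served P tie t (arrivals P T t s z) z = some u then 1 else 0 := by
  rcases h : served P tie t (arrivals P T t s z) z with _ | v
  · rw [step_of_none P T tie t s z h]
    simp [arrivals]
  · rw [step_of_some P T tie t s z h, transmit_att]
    simp [arrivals]

theorem step_recv (u : UE A L R) :
    (step P T tie t s z).recv u =
      s.recv u + if served P tie t (arrivals P T t s z) z = some u ∧ z.chan u = true
        then 1 else 0 := by
  rcases h : served P tie t (arrivals P T t s z) z with _ | v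
  · rw [step_of_none P T tie t s z h]
    simp [arrivals]
  · rw [step_of_some P T tie t s z h, transmit_recv]
    simp [arrivals]

theorem step_a : (step P T tie t s z).a = (arrivals P T t s z).a := by
  rcases h : served P tie t (arrivals P T t s z) z with _ | v
  · rw [step_of_none P T tie t s z h]
  · rw [step_of_some P T tie t s z h, transmit_a]

theorem step_b : (step P T tie t s z).b = (arrivals P T t s z).b := by
  rcases h : served P tie t (arrivals P T t s z) z with _ | v
  · rw [step_of_none P T tie t s z h]
  · rw [step_of_some P T tie t s z h, transmit_b]

theorem step_W (i : A) : (step P T tie t s z).W i =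
    if served P tie t (arrivals P T t s z) z = some (.aoi i) ∧ z.chan (.aoi i) = true then 0
      else (arrivals P T t s z).W i := by
  rcases h : served P tie t (arrivals P T t s z) z with _ | v
  · rw [step_of_none P T tie t s z h]
    simp
  · rw [step_of_some P T tie t s z h, transmit_W]
    simp

variable {tie}

theorem bestUE_mem (htie : IsTieRule tie) {u : UE A L R} (h : bestUE P tie t s = some u) :
    u ∈ candidates P t s := by
  unfold bestUE at h
  split_ifs at h with hne
  rw [← Option.some.inj h]
  exact htie t s _ hne

theorem served_aoi (htie : IsTieRule tie) {i : A} (h : served P tie t s z = some (.aoi i)) :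
    0 < s.W i := by
  unfold served at h
  split at h
  · simp at h
  · have := bestUE_mem P t s htie h
    unfold candidates at this
    split_ifs at this with hW
    · obtain ⟨i', hi'⟩ := hW
      simp only [Finset.mem_filter, Finset.mem_univ, true_and, UE.aoi.injEq] at this
      obtain ⟨i'', rfl, h2⟩ := this
      exact hi'.trans_le (h2 i')
    · simp at this

theorem served_thr (htie : IsTieRule tie) {k : R} (h : served P tie t s z = some (.thr k)) :
    ∀ k', Y P t s k' ≤ Y P t s k := by
  unfold served at h
  split at h
  · simp at h
  · have := bestUE_mem P t s htie h
    unfold candidates at this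
    split_ifs at this with hW
    · simp at this
    · simp only [Finset.mem_filter, Finset.mem_univ, true_and, UE.thr.injEq] at this
      obtain ⟨k', rfl, h2⟩ := this
      exact h2

theorem served_lat_iff (htie : IsTieRule tie) {j : L} :
    served P tie t s z = some (.lat j) ↔ z.token = some j ∧ (s.buf j).Nonempty := by
  have hpick : pick (backlogged s) z.token = some j ↔
      z.token = some j ∧ (s.buf j).Nonempty := by
    simp only [pick, Option.filter_eq_some_iff, backlogged]
    simp
  rw [← hpick]
  unfold served
  split
  · rename_i j' h
    simp [h]
  · rename_i h
    simp only [h, reduceCtorEq, iff_false]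
    intro h'
    have := bestUE_mem P t s htie h'
    unfold candidates at this
    split_ifs at this <;> simp at this

/-- Some user is served in every slot if there is a throughput user. -/
theorem served_isSome [Nonempty R] : ∃ u, served P tie t s z = some u := by
  unfold served
  split
  · exact ⟨_, rfl⟩
  · have hne : (candidates P t s).Nonempty := by
      unfold candidates
      split_ifs with hW
      · obtain ⟨i', -⟩ := hW
        obtain ⟨i, -, hi⟩ := Finset.exists_max_image Finset.univ s.W ⟨i', Finset.mem_univ _⟩
        exact ⟨.aoi i, by simpa using hi⟩
      · obtain ⟨k, -, hk⟩ := Finset.exists_max_image Finset.univ (Y P t s) Finset.univ_nonempty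
        exact ⟨.thr k, by simpa using hk⟩
    simp [bestUE, hne]

theorem step_buf (htie : IsTieRule tie) (j : L) : (step P T tie t s z).buf j =
    if svc j z = true then ((arrivals P T t s z).buf j).erase (((arrivals P T t s z).buf j).sup id)
      else (arrivals P T t s z).buf j := by
  have hiff := served_lat_iff P t (arrivals P T t s z) z htie (j := j)
  by_cases hempty : ((arrivals P T t s z).buf j).Nonempty
  · rcases h : served P tie t (arrivals P T t s z) z with _ | v
    · rw [step_of_none P T tie t s z h]
      simp only [h, reduceCtorEq, hempty, and_true, false_iff] at hiff
      simp [svc, hiff]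
    · rw [step_of_some P T tie t s z h, transmit_buf]
      simp only [h, Option.some.injEq, hempty, and_true] at hiff
      simp [svc, hiff]
  · have h0 := Finset.not_nonempty_iff_eq_empty.1 hempty
    rcases h : served P tie t (arrivals P T t s z) z with _ | v
    · rw [step_of_none P T tie t s z h]
      simp [h0]
    · rw [step_of_some P T tie t s z h, transmit_buf]
      simp [h0]

theorem step_rcv (htie : IsTieRule tie) (j : L) : (step P T tie t s z).rcv j =
    if svc j z = true ∧ ((arrivals P T t s z).buf j).Nonempty
      then Function.update (s.rcv j) (((arrivals P T t s z).buf j).sup id) (some t)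
      else s.rcv j := by
  have hiff := served_lat_iff P t (arrivals P T t s z) z htie (j := j)
  have h1 : (arrivals P T t s z).rcv = s.rcv := rfl
  rcases h : served P tie t (arrivals P T t s z) z with _ | v
  · rw [step_of_none P T tie t s z h]
    simp only [h, reduceCtorEq, false_iff] at hiff
    rw [if_neg, h1]
    rintro ⟨h2, h3⟩
    simp [svc] at h2
    exact hiff ⟨h2.1, h3⟩
  · rw [step_of_some P T tie t s z h, transmit_rcv, h1]
    simp only [h, Option.some.injEq] at hiff
    refine if_congr ?_ rfl rfl
    rw [hiff]
    simp only [svc, Bool.and_eq_true, decide_eq_true_eq]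
    tauto

theorem step_recv_lat (htie : IsTieRule tie) (j : L) : (step P T tie t s z).recv (.lat j) =
    s.recv (.lat j) + if svc j z = true ∧ ((arrivals P T t s z).buf j).Nonempty then 1 else 0 := by
  rw [step_recv]
  congr 1
  refine if_congr ?_ rfl rfl
  rw [served_lat_iff P t _ z htie]
  simp only [svc, Bool.and_eq_true, decide_eq_true_eq]
  tauto

end Step

/-! ### Trajectories -/

section Run

variable (P : Params A L R) (T : A → ℝ) (tie : TieRule A L R)

theorem run_dependsOn (n : ℕ) :
    DependsOn (fun z => run P T tie z n) (Finset.Iic n : Set ℕ) := by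
  induction n with
  | zero => intro z z' _; rfl
  | succ n ih =>
    intro z z' h
    have h1 : run P T tie z n = run P T tie z' n := ih fun i hi => h i (by simp at hi ⊢; omega)
    have h2 : z (n + 1) = z' (n + 1) := h _ (by simp)
    simp only [run, h1, h2]

end Run

/-! ### The queue of a latency user -/

section Queue

variable (P : Params A L R) (T : A → ℝ) (tie : TieRule A L R) (j : L)

/-- Number of stored packets of the latency user `j` at the end of slot `n`. -/
noncomputable def queue (z : ℕ → Input A L R) (n : ℕ) : ℕ := ((run P T tie z n).buf j).card

theorem queue_dependsOn (n : ℕ) :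
    DependsOn (fun z => queue P T tie j z n) (Finset.Iic n : Set ℕ) := fun z z' h => by
  have := run_dependsOn P T tie n h
  simp only [queue] at this ⊢
  rw [this]

theorem arrived_succ (z : ℕ → Input A L R) (n : ℕ) : arrived z j (n + 1) =
    if (z (n + 1)).arrL j = true then insert (n + 1) (arrived z j n) else arrived z j n := by
  unfold arrived
  rw [← Finset.insert_Icc_right_eq_Icc_add_one (by omega), Finset.filter_insert]

theorem notMem_arrived_succ (z : ℕ → Input A L R) (n : ℕ) : n + 1 ∉ arrived z j n := by
  simp [arrived]

theorem card_arrived (z : ℕ → Input A L R) (n : ℕ) :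
    (arrived z j n).card = ∑ i ∈ Finset.range n, ((z (i + 1)).arrL j).toNat := by
  induction n with
  | zero => simp [arrived]
  | succ n ih =>
    rw [Finset.sum_range_succ, ← ih, arrived_succ]
    cases (z (n + 1)).arrL j
    · simp
    · simp [notMem_arrived_succ]

variable {tie}

/-- The stored packets are those that have arrived and have not been received. -/
theorem mem_buf_iff (htie : IsTieRule tie) (z : ℕ → Input A L R) (n g : ℕ) :
    (g ∈ (run P T tie z n).buf j ↔ g ∈ arrived z j n ∧ (run P T tie z n).rcv j g = none) ∧
      ((run P T tie z n).rcv j g ≠ none → g ∈ arrived z j n) := by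
  induction n with
  | zero => simp [run, State.init, arrived]
  | succ n ih =>
    obtain ⟨ih1, ih2⟩ := ih
    set s := run P T tie z n
    have hb : (arrivals P T (n + 1) s (z (n + 1))).buf j =
      if (z (n + 1)).arrL j then insert (n + 1) (s.buf j) else s.buf j := rfl
    have hnew := notMem_arrived_succ j z n
    have h1 : g ∈ (arrivals P T (n + 1) s (z (n + 1))).buf j ↔
        g ∈ arrived z j (n + 1) ∧ s.rcv j g = none := by
      rw [hb, arrived_succ]
      grind
    have h2 : s.rcv j g ≠ none → g ∈ arrived z j (n + 1) := by
      rw [arrived_succ]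
      grind
    simp only [run]
    rw [step_buf P T (n + 1) s (z (n + 1)) htie, step_rcv P T (n + 1) s (z (n + 1)) htie]
    by_cases hne : ((arrivals P T (n + 1) s (z (n + 1))).buf j).Nonempty
    · obtain ⟨m, hm, hsup⟩ := Finset.exists_mem_eq_sup _ hne id
      rw [hsup]
      simp only [id]
      grind
    · have h0 := Finset.not_nonempty_iff_eq_empty.1 hne
      simp only [hne, and_false, if_false]
      grind

theorem notMem_buf_succ (htie : IsTieRule tie) (z : ℕ → Input A L R) (n : ℕ) :
    n + 1 ∉ (run P T tie z n).buf j := fun h =>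
  notMem_arrived_succ j z n ((mem_buf_iff P T j htie z n _).1.1 h).1

theorem card_arrivals_buf (htie : IsTieRule tie) (z : ℕ → Input A L R) (n : ℕ) :
    ((arrivals P T (n + 1) (run P T tie z n) (z (n + 1))).buf j).card =
      queue P T tie j z n + ((z (n + 1)).arrL j).toNat := by
  have hb : (arrivals P T (n + 1) (run P T tie z n) (z (n + 1))).buf j =
      if (z (n + 1)).arrL j then insert (n + 1) ((run P T tie z n).buf j)
        else (run P T tie z n).buf j := rfl
  rw [hb, queue]
  cases (z (n + 1)).arrL j
  · simp
  · simp [Finset.card_insert_of_notMem (notMem_buf_succ P T j htie z n)]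

/-- Lindley's recursion. -/
theorem queue_succ (htie : IsTieRule tie) (z : ℕ → Input A L R) (n : ℕ) :
    queue P T tie j z (n + 1) =
      queue P T tie j z n + ((z (n + 1)).arrL j).toNat - (svc j (z (n + 1))).toNat := by
  rw [← card_arrivals_buf P T j htie]
  conv_lhs => rw [queue, run, step_buf P T _ _ _ htie]
  cases svc j (z (n + 1))
  · simp
  · simp only [if_true, Bool.toNat_true]
    rcases Finset.eq_empty_or_nonempty
      ((arrivals P T (n + 1) (run P T tie z n) (z (n + 1))).buf j) with h0 | hne
    · simp [h0]
    · obtain ⟨m, hm, hsup⟩ := Finset.exists_mem_eq_sup _ hne id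
      rw [hsup, id, Finset.card_erase_of_mem hm]

theorem recv_lat_add_queue (htie : IsTieRule tie) (z : ℕ → Input A L R) (n : ℕ) :
    (run P T tie z n).recv (.lat j) + queue P T tie j z n = (arrived z j n).card := by
  induction n with
  | zero => simp [run, State.init, arrived, queue]
  | succ n ih =>
    rw [queue_succ P T j htie, card_arrived, Finset.sum_range_succ, ← card_arrived, ← ih]
    conv_lhs => rw [run, step_recv_lat P T _ _ _ htie]
    have hc := card_arrivals_buf P T j htie z n
    have hpos := Finset.card_pos
      (s := (arrivals P T (n + 1) (run P T tie z n) (z (n + 1))).buf j)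
    rw [hc] at hpos
    cases svc j (z (n + 1))
    · simp
      omega
    · simp only [true_and, ← hpos, Bool.toNat_true]
      split_ifs <;> omega

/-- A packet contributes one unit of latency for every slot in which it is in the queue. -/
theorem sum_latency (htie : IsTieRule tie) (z : ℕ → Input A L R) (n : ℕ) :
    ∑ g ∈ arrived z j n, (((((run P T tie z n).rcv j g).getD n : ℕ) : ℝ) - (g : ℝ) + 1) =
      ∑ i ∈ Finset.range n, (queue P T tie j z i : ℝ) + (arrived z j n).card := by
  induction n with
  | zero => simp [arrived]
  | succ n ih =>
    set s := run P T tie z n with hs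
    have hmem := fun g => mem_buf_iff P T j htie z n g
    rw [← hs] at hmem
    have hrcv : (run P T tie z (n + 1)).rcv j = if svc j (z (n + 1)) = true ∧
        ((arrivals P T (n + 1) s (z (n + 1))).buf j).Nonempty
      then Function.update (s.rcv j) (((arrivals P T (n + 1) s (z (n + 1))).buf j).sup id)
        (some (n + 1)) else s.rcv j := step_rcv P T _ _ _ htie j
    have hb : (arrivals P T (n + 1) s (z (n + 1))).buf j =
      if (z (n + 1)).arrL j then insert (n + 1) (s.buf j) else s.buf j := rfl
    have hnew : ((run P T tie z (n + 1)).rcv j (n + 1)).getD (n + 1) = n + 1 := by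
      have h0 : s.rcv j (n + 1) = none := by
        by_contra h
        exact notMem_arrived_succ j z n ((hmem _).2 h)
      rw [hrcv]
      split_ifs
      · rw [Function.update_apply]
        split_ifs <;> simp [h0]
      · simp [h0]
    have hold : ∀ g ∈ arrived z j n,
        ((((run P T tie z (n + 1)).rcv j g).getD (n + 1) : ℕ) : ℝ) - g + 1 =
          ((((s.rcv j g).getD n : ℕ) : ℝ) - g + 1) + if g ∈ s.buf j then 1 else 0 := by
      intro g hg
      have hgn : g ≠ n + 1 := fun h => notMem_arrived_succ j z n (h ▸ hg)
      have hcase : ((run P T tie z (n + 1)).rcv j g).getD (n + 1) =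
          (s.rcv j g).getD n + if g ∈ s.buf j then 1 else 0 := by
        have hsame : ((s.rcv j g).getD (n + 1)) =
            (s.rcv j g).getD n + if g ∈ s.buf j then 1 else 0 := by
          have := (hmem g).1
          rcases h : s.rcv j g with _ | r <;> simp_all
        rw [hrcv]
        by_cases h1 : svc j (z (n + 1)) = true ∧
          ((arrivals P T (n + 1) s (z (n + 1))).buf j).Nonempty
        · obtain ⟨m, hm, hsup⟩ := Finset.exists_mem_eq_sup _ h1.2 id
          rw [if_pos h1, hsup, Function.update_apply]
          by_cases h2 : g = id m
          · have hgb : g ∈ s.buf j := by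
              rw [hb] at hm
              simp only [id] at h2
              grind
            have := ((hmem g).1.1 hgb).2
            rw [if_pos h2, if_pos hgb, this]
            simp
          · rw [if_neg h2]
            exact hsame
        · rw [if_neg h1]
          exact hsame
      rw [hcase]
      push_cast
      ring
    have hsum : ∑ g ∈ arrived z j n, ((((run P T tie z (n + 1)).rcv j g).getD (n + 1) : ℕ) -
        (g : ℝ) + 1) = ∑ i ∈ Finset.range n, (queue P T tie j z i : ℝ) + (arrived z j n).card +
          queue P T tie j z n := by
      rw [Finset.sum_congr rfl hold, Finset.sum_add_distrib, ih]
      congr 1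
      rw [Finset.sum_boole, queue]
      congr 2
      ext g
      have := (hmem g).1
      simp only [Finset.mem_filter]
      tauto
    rw [arrived_succ, Finset.sum_range_succ]
    split_ifs with h
    · rw [Finset.sum_insert (notMem_arrived_succ j z n), hnew, hsum,
        Finset.card_insert_of_notMem (notMem_arrived_succ j z n)]
      push_cast
      ring
    · rw [hsum]
      ring

/-- Increment of `Q (Q + 1) / 2` in one slot. -/
theorem queue_sq_succ (htie : IsTieRule tie) (z : ℕ → Input A L R) (n : ℕ) :
    (queue P T tie j z (n + 1) : ℝ) * (queue P T tie j z (n + 1) + 1) / 2 =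
      (queue P T tie j z n : ℝ) * (queue P T tie j z n + 1) / 2 +
      (queue P T tie j z n *
        ((((z (n + 1)).arrL j).toNat : ℝ) - ((svc j (z (n + 1))).toNat : ℝ)) +
        (((z (n + 1)).arrL j).toNat : ℝ) * (1 - ((svc j (z (n + 1))).toNat : ℝ))) := by
  rw [queue_succ P T j htie]
  cases (z (n + 1)).arrL j <;> cases svc j (z (n + 1)) <;> simp
  · rcases queue P T tie j z n with _ | m <;> simp
    ring
  · ring

end Queue

section QueueLimit

variable {P : Params A L R} {Ω : Type*} [MeasurableSpace Ω] {μ : Measure Ω}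
  [IsProbabilityMeasure μ] {Z : ℕ → Ω → Input A L R} (T : A → ℝ) {tie : TieRule A L R} (j : L)

theorem θ_nonneg (P : Params A L R) (j : L) : 0 ≤ P.θ j := by
  have := P.qL_le j
  have := (P.qL_pos j).le
  have := (P.β_pos j).le
  have := (P.p_pos (.lat j)).le
  unfold Params.θ
  have : 0 ≤ 1 - P.qL j := by linarith
  positivity

theorem svcRate_nonneg (P : Params A L R) (j : L) : 0 ≤ P.svcRate j :=
  mul_nonneg (θ_nonneg P j) (P.p_pos _).le

theorem svcRate_le_one (hθ : ∑ j, P.θ j ≤ 1) : P.svcRate j ≤ 1 := by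
  have : P.θ j ≤ 1 :=
    (Finset.single_le_sum (fun i _ => θ_nonneg P i) (Finset.mem_univ j)).trans hθ
  exact mul_le_one₀ this (P.p_pos _).le (P.p_le _)

theorem svcRate_eq (P : Params A L R) (j : L) :
    P.svcRate j = P.qL j + (1 - P.qL j) / P.β j := by
  have := (P.p_pos (.lat j)).ne'
  unfold Params.svcRate Params.θ
  field_simp

/-- If services are more likely than arrivals, an exponential function of the queue length drifts
downwards. -/
theorem exists_exp_drift {q s : ℝ} (hq : 0 < q) (hqs : q < s) (hs : s ≤ 1) :
    ∃ x : ℝ, 1 < x ∧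
      ∑ a, ∑ b, bern q a * (bern s b * (x ^ a.toNat * x⁻¹ ^ b.toNat)) < 1 := by
  obtain ⟨x, hx1, hx2⟩ : ∃ x : ℝ, 1 < x ∧ q * (1 - s) * x < s * (1 - q) := by
    rcases hs.eq_or_lt with rfl | hs
    · exact ⟨2, one_lt_two, by nlinarith⟩
    · have h : 0 < q * (1 - s) := mul_pos hq (by linarith)
      obtain ⟨x, h1, h2⟩ := exists_between
        (show 1 < s * (1 - q) / (q * (1 - s)) by rw [lt_div_iff₀ h]; nlinarith)
      exact ⟨x, h1, by rw [lt_div_iff₀ h] at h2; linarith⟩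
  refine ⟨x, hx1, ?_⟩
  have hx0 : 0 < x := by linarith
  have hxx : x * x⁻¹ = 1 := mul_inv_cancel₀ hx0.ne'
  have hkey : 0 < (x - 1) * (s * (1 - q) - q * (1 - s) * x) * x⁻¹ := by
    have : 0 < x - 1 := by linarith
    have : 0 < s * (1 - q) - q * (1 - s) * x := by linarith
    positivity
  have h1 : (x - 1) * (s * (1 - q) - q * (1 - s) * x) * x⁻¹ =
      s * (1 - q) * (1 - x⁻¹) - q * (1 - s) * (x - 1) := by
    field_simp
  simp [bern]
  rw [hxx]
  nlinarith

theorem exists_sq_le_pow {x : ℝ} (hx : 1 < x) :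
    ∃ K : ℝ, 0 ≤ K ∧ ∀ n : ℕ, ((n : ℝ) + 1) ^ 2 ≤ K * x ^ n := by
  have hx0 : 0 < x := by linarith
  have h := tendsto_pow_const_mul_const_pow_of_abs_lt_one 2
    (show |x⁻¹| < 1 by rw [abs_of_pos (by positivity)]; exact inv_lt_one_of_one_lt₀ hx)
  obtain ⟨K, hK⟩ := h.bddAbove_range
  have hK' : ∀ n : ℕ, (n : ℝ) ^ 2 ≤ K * x ^ n := fun n => by
    have := hK ⟨n, rfl⟩
    simp only [inv_pow] at this
    rwa [← div_eq_mul_inv, div_le_iff₀ (by positivity)] at this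
  have hK0 : 0 ≤ K := by simpa using hK' 0
  refine ⟨K * x, by positivity, fun n => ?_⟩
  have := hK' (n + 1)
  push_cast at this
  rw [pow_succ x] at this
  linarith

/-- The second moment of the queue length is bounded. -/
theorem exists_integral_queue_le (hZ : IsDriver P μ Z) (htie : IsTieRule tie)
    (hθ : ∑ j, P.θ j ≤ 1) (hqs : P.qL j < P.svcRate j) :
    ∃ C : ℝ, ∀ n, ∫ ω, ((queue P T tie j (fun t => Z t ω) n : ℝ) + 1) ^ 2 ∂μ ≤ C := by
  obtain ⟨x, hx, hr⟩ := exists_exp_drift (P.qL_pos j) hqs (svcRate_le_one j hθ)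
  set r := ∑ a, ∑ b, bern (P.qL j) a * (bern (P.svcRate j) b * (x ^ a.toNat * x⁻¹ ^ b.toNat))
  have hx0 : 0 < x := by linarith
  obtain ⟨K, hK0, hK⟩ := exists_sq_le_pow hx
  have hdep : ∀ n, ∀ f : ℕ → ℝ,
      DependsOn (fun z => f (queue P T tie j z n)) (Finset.Iic n : Set ℕ) :=
    fun n f z z' h => by
      have := queue_dependsOn P T tie j n h
      simp only at this ⊢
      rw [this]
  have hint : ∀ n, ∀ f : ℕ → ℝ,
      Integrable (fun ω => f (queue P T tie j (fun t => Z t ω) n)) μ := fun n f =>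
    integrable_of_dependsOn hZ.measurable (hdep n f)
  have hexp : ∀ n, ∫ ω, x ^ (queue P T tie j (fun t => Z t ω) n) ∂μ ≤ 1 + 1 / (1 - r) := by
    intro n
    have hr' : 0 < 1 - r := by linarith
    induction n with
    | zero =>
      simp [queue, run, State.init]
      exact hr.le
    | succ n ih =>
      set G : (ℕ → Input A L R) → Input A L R → ℝ := fun z y => x ^ (queue P T tie j z n) *
        (x ^ (y.arrL j).toNat * x⁻¹ ^ (svc j y).toNat)
      have hG : DependsOn G (Finset.Iic n : Set ℕ) := fun z z' h => by
        have := queue_dependsOn P T tie j n h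
        ext y
        simp only [G] at this ⊢
        rw [this]
      have hfresh := integral_fresh (μ := μ) hZ.measurable hZ.indep hZ.law hG
      have hval : ∀ z, ∑ y, P.inputProb y * G z y = r * x ^ (queue P T tie j z n) := fun z => by
        have := sum_inputProb_lat P j fun a b => x ^ (queue P T tie j z n) *
          (x ^ a.toNat * x⁻¹ ^ b.toNat)
        rw [this]
        simp only [r, Finset.sum_mul]
        refine Finset.sum_congr rfl fun a _ => Finset.sum_congr rfl fun b _ => by ring
      simp only [hval] at hfresh
      rw [integral_const_mul] at hfresh
      have hGi : Integrable (fun ω => G (fun t => Z t ω) (Z (n + 1) ω)) μ :=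
        integrable_of_dependsOn hZ.measurable (dependsOn_succ hG)
      have hle : ∫ ω, x ^ (queue P T tie j (fun t => Z t ω) (n + 1)) ∂μ ≤
          ∫ ω, (G (fun t => Z t ω) (Z (n + 1) ω) + 1) ∂μ := by
        refine integral_mono (hint (n + 1) fun m => x ^ m) (hGi.add (integrable_const 1))
          fun ω => ?_
        simp only [G, queue_succ P T j htie]
        have hpos : 0 < x ^ (queue P T tie j (fun t => Z t ω) n) := by positivity
        cases (Z (n + 1) ω).arrL j <;> cases svc j (Z (n + 1) ω) <;> simp
        · rcases queue P T tie j (fun t => Z t ω) n with _ | m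
          · simp
            positivity
          · rw [Nat.add_sub_cancel, pow_succ, mul_assoc, mul_inv_cancel₀ hx0.ne']
            linarith
        · rw [pow_succ]
          linarith
        · rw [mul_inv_cancel₀ hx0.ne']
          linarith
      rw [integral_add hGi (integrable_const 1), hfresh] at hle
      have hr0 : 0 ≤ r := by
        have h1 := P.qL_le j
        have h2 := (P.qL_pos j).le
        have h3 := svcRate_le_one j hθ
        have h4 := svcRate_nonneg P j
        have hb : ∀ y : ℝ, 0 ≤ y → y ≤ 1 → ∀ b, 0 ≤ bern y b := fun y h h' b => by
          cases b <;> simp [bern] <;> linarith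
        refine Finset.sum_nonneg fun a _ => Finset.sum_nonneg fun b _ => ?_
        have := hb _ h2 h1 a
        have := hb _ h4 h3 b
        positivity
      have h5 := mul_le_mul_of_nonneg_left ih hr0
      have h6 : (1 - r) * (1 / (1 - r)) = 1 := by field_simp
      simp at hle
      nlinarith
  refine ⟨K * (1 + 1 / (1 - r)), fun n => ?_⟩
  calc ∫ ω, ((queue P T tie j (fun t => Z t ω) n : ℝ) + 1) ^ 2 ∂μ
      ≤ ∫ ω, K * x ^ (queue P T tie j (fun t => Z t ω) n) ∂μ :=
        integral_mono (hint n fun m => ((m : ℝ) + 1) ^ 2) (hint n fun m => K * x ^ m)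
          fun ω => hK _
    _ ≤ K * (1 + 1 / (1 - r)) := by
        rw [integral_const_mul]
        exact mul_le_mul_of_nonneg_left (hexp n) hK0

/-- The time average of a stable queue. -/
theorem ae_tendsto_sum_queue_of_lt (hZ : IsDriver P μ Z) (htie : IsTieRule tie)
    (hθ : ∑ j, P.θ j ≤ 1) (hqs : P.qL j < P.svcRate j) :
    ∀ᵐ ω ∂μ, Tendsto (fun n : ℕ =>
      (∑ i ∈ Finset.range n, (queue P T tie j (fun t => Z t ω) i : ℝ)) / n) atTop
      (𝓝 (P.qL j * (1 - P.svcRate j) / (P.svcRate j - P.qL j))) := by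
  obtain ⟨C, hC⟩ := exists_integral_queue_le T j hZ htie hθ hqs
  have q0 := P.qL_pos j
  have q1 := P.qL_le j
  have s0 := svcRate_nonneg P j
  have s1 := svcRate_le_one j hθ
  set q := P.qL j with hq
  set s := P.svcRate j with hs
  have hdep : ∀ n, ∀ f : ℕ → ℝ,
      DependsOn (fun z => f (queue P T tie j z n)) (Finset.Iic n : Set ℕ) :=
    fun n f z z' h => by
      have := queue_dependsOn P T tie j n h
      simp only at this ⊢
      rw [this]
  have hint : ∀ n, ∀ f : ℕ → ℝ,
      Integrable (fun ω => f (queue P T tie j (fun t => Z t ω) n)) μ := fun n f =>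
    integrable_of_dependsOn hZ.measurable (hdep n f)
  -- the centred increments of `Q (Q + 1) / 2`
  set D : ℕ → (ℕ → Input A L R) → Input A L R → ℝ := fun n z y =>
    queue P T tie j z n * (((y.arrL j).toNat : ℝ) - ((svc j y).toNat : ℝ) - (q - s)) +
      (((y.arrL j).toNat : ℝ) * (1 - ((svc j y).toNat : ℝ)) - q * (1 - s)) with hDdef
  have hD : ∀ n, DependsOn (D n) (Finset.Iic n : Set ℕ) := fun n z z' h => by
    have := queue_dependsOn P T tie j n h
    ext y
    simp only [D] at this ⊢
    rw [this]
  have hzero : ∀ n z, ∑ y, P.inputProb y * D n z y = 0 := fun n z => by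
    have := sum_inputProb_lat P j fun a b =>
      (queue P T tie j z n : ℝ) * ((a.toNat : ℝ) - (b.toNat : ℝ) - (q - s)) +
      ((a.toNat : ℝ) * (1 - (b.toNat : ℝ)) - q * (1 - s))
    rw [this]
    simp [bern, ← hq, ← hs]
    ring
  have hDle : ∀ n z y, D n z y ^ 2 ≤ 4 * ((queue P T tie j z n : ℝ) + 1) ^ 2 := fun n z y => by
    have hQ : (0 : ℝ) ≤ queue P T tie j z n := Nat.cast_nonneg _
    have hab : |D n z y| ≤ 2 * ((queue P T tie j z n : ℝ) + 1) := by
      rw [abs_le]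
      simp only [D]
      have := mul_nonneg q0.le (sub_nonneg.2 s1)
      have : q * (1 - s) ≤ 1 := by nlinarith
      cases y.arrL j <;> cases svc j y <;> constructor <;> simp <;> nlinarith
    calc D n z y ^ 2 ≤ (2 * ((queue P T tie j z n : ℝ) + 1)) ^ 2 :=
          sq_le_sq' (abs_le.1 hab).1 (abs_le.1 hab).2
      _ = _ := by ring
  have hM := ae_tendsto_sum_div_sq hZ.measurable hZ.indep hZ.law hD hzero (C := 4 * C) fun n => by
    calc ∫ ω, D n (fun t => Z t ω) (Z (n + 1) ω) ^ 2 ∂μ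
        ≤ ∫ ω, 4 * ((queue P T tie j (fun t => Z t ω) n : ℝ) + 1) ^ 2 ∂μ :=
          integral_mono_of_nonneg (ae_of_all _ fun ω => sq_nonneg _)
            (hint n fun m => 4 * ((m : ℝ) + 1) ^ 2) (ae_of_all _ fun ω => hDle _ _ _)
      _ ≤ 4 * C := by
          rw [integral_const_mul]
          linarith [hC n]
  have hΦ := ae_tendsto_zero_of_integral_le (μ := μ) (C := C)
    (Y := fun k ω => (queue P T tie j (fun t => Z t ω) (k ^ 2) : ℝ) *
      (queue P T tie j (fun t => Z t ω) (k ^ 2) + 1) / 2 / (k : ℝ) ^ 2)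
    (fun k ω => by positivity)
    (fun k => hint (k ^ 2) fun m => (m : ℝ) * (m + 1) / 2 / (k : ℝ) ^ 2) fun k => by
      rw [integral_div]
      refine div_le_div_of_nonneg_right ?_ (by positivity)
      refine le_trans (integral_mono (hint (k ^ 2) fun m => (m : ℝ) * (m + 1) / 2)
        (hint (k ^ 2) fun m => ((m : ℝ) + 1) ^ 2) fun ω => ?_) (hC (k ^ 2))
      have : (0 : ℝ) ≤ queue P T tie j (fun t => Z t ω) (k ^ 2) := Nat.cast_nonneg _
      simp only
      nlinarith
  filter_upwards [hM, hΦ] with ω h1 h2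
  refine tendsto_div_of_monotone_of_sq (monotone_nat_of_le_succ fun n => by
    rw [Finset.sum_range_succ]
    have : (0 : ℝ) ≤ queue P T tie j (fun t => Z t ω) n := Nat.cast_nonneg _
    linarith) ?_
  have hsum : ∀ n : ℕ, (queue P T tie j (fun t => Z t ω) n : ℝ) *
      (queue P T tie j (fun t => Z t ω) n + 1) / 2 =
      ∑ i ∈ Finset.range n, D i (fun t => Z t ω) (Z (i + 1) ω) -
        (s - q) * ∑ i ∈ Finset.range n, (queue P T tie j (fun t => Z t ω) i : ℝ) +
        n * (q * (1 - s)) := fun n => by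
    induction n with
    | zero => simp [queue, run, State.init]
    | succ n ih =>
      rw [queue_sq_succ P T j htie, ih, Finset.sum_range_succ, Finset.sum_range_succ]
      simp only [D]
      push_cast
      ring
  have h3 := ((h1.sub h2).add_const (q * (1 - s))).div_const (s - q)
  rw [sub_zero, zero_add] at h3
  refine h3.congr' ?_
  filter_upwards [eventually_gt_atTop 0] with k hk
  have hk' : (k : ℝ) ≠ 0 := by positivity
  have hsq : s - q ≠ 0 := by linarith
  have := hsum (k ^ 2)
  rw [this]
  push_cast
  field_simp
  ring

theorem queue_eq_zero_of_svc (htie : IsTieRule tie) {z : ℕ → Input A L R}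
    (h : ∀ n, svc j (z (n + 1)) = true) (n : ℕ) : queue P T tie j z n = 0 := by
  induction n with
  | zero => simp [queue, run, State.init]
  | succ n ih =>
    rw [queue_succ P T j htie, ih, h n]
    cases (z (n + 1)).arrL j <;> simp

/-- If services are certain, they occur in all slots. -/
theorem ae_svc_of_svcRate_eq_one (hZ : IsDriver P μ Z) (h : P.svcRate j = 1) :
    ∀ᵐ ω ∂μ, ∀ n, svc j (Z (n + 1) ω) = true := by
  refine ae_all_iff.2 fun n => ?_
  set G : (ℕ → Input A L R) → Input A L R → ℝ := fun _ y => 1 - ((svc j y).toNat : ℝ)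
  have hG : DependsOn G (Finset.Iic n : Set ℕ) := fun _ _ _ => rfl
  have h0 := integral_fresh (μ := μ) hZ.measurable hZ.indep hZ.law hG
  have hval : ∀ z, ∑ y, P.inputProb y * G z y = 0 := fun z => by
    have := sum_inputProb_lat P j fun _ b => 1 - (b.toNat : ℝ)
    simp only [G]
    rw [this]
    simp [bern, h]
  simp only [hval, integral_zero] at h0
  have hpos : ∀ ω, 0 ≤ G (fun t => Z t ω) (Z (n + 1) ω) := fun ω => by
    simp only [G]
    cases svc j (Z (n + 1) ω) <;> simp
  have hGi : Integrable (fun ω => G (fun t => Z t ω) (Z (n + 1) ω)) μ :=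
    integrable_of_dependsOn hZ.measurable (dependsOn_succ hG)
  filter_upwards [(integral_eq_zero_iff_of_nonneg hpos hGi).1 h0] with ω hω
  simp only [G, Pi.zero_apply] at hω
  by_contra hne
  simp [Bool.not_eq_true _ ▸ hne] at hω

/-- The time average of the queue of a latency user; together with the packets in service it gives,
by Little's law, an average latency of at most `β j`. -/
theorem exists_ae_tendsto_sum_queue (hZ : IsDriver P μ Z) (htie : IsTieRule tie)
    (hθ : ∑ j, P.θ j ≤ 1) (hβ : P.qL j = 1 → 1 ≤ P.β j) :
    ∃ κ : ℝ, (κ + P.qL j) / P.qL j ≤ P.β j ∧ ∀ᵐ ω ∂μ, Tendsto (fun n : ℕ =>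
      (∑ i ∈ Finset.range n, (queue P T tie j (fun t => Z t ω) i : ℝ)) / n) atTop (𝓝 κ) := by
  have hs := svcRate_eq P j
  have b0 := P.β_pos j
  have q0 := P.qL_pos j
  rcases (P.qL_le j).eq_or_lt with h1 | h1
  · refine ⟨0, by simpa [h1] using hβ h1, ?_⟩
    filter_upwards [ae_svc_of_svcRate_eq_one (P := P) j hZ (by rw [hs, h1]; simp)] with ω hω
    simp [queue_eq_zero_of_svc (P := P) T j htie (z := fun t => Z t ω) hω]
  · have h2 : 0 < (1 - P.qL j) / P.β j := div_pos (by linarith) b0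
    refine ⟨_, le_of_eq ?_, ae_tendsto_sum_queue_of_lt T j hZ htie hθ (by linarith)⟩
    rw [hs]
    have : 1 - P.qL j ≠ 0 := by linarith
    field_simp
    simp only [add_sub_cancel_left]
    field_simp
    ring

theorem ae_tendsto_card_arrived (hZ : IsDriver P μ Z) :
    ∀ᵐ ω ∂μ, Tendsto (fun n : ℕ => ((arrived (fun t => Z t ω) j n).card : ℝ) / n) atTop
      (𝓝 (P.qL j)) := by
  have q0 := P.qL_pos j
  have q1 := P.qL_le j
  have h := ae_tendsto_sum_div (μ := μ) hZ.measurable hZ.indep hZ.law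
    (D := fun _ _ y => ((y.arrL j).toNat : ℝ) - P.qL j) (K := 1) (fun _ _ _ _ => rfl)
    (fun n z => by
      have := sum_inputProb_lat P j fun a _ => (a.toNat : ℝ) - P.qL j
      rw [this]
      simp [bern]
      ring)
    (fun n z y => by
      rw [abs_le]
      cases y.arrL j <;> constructor <;> simp <;> linarith)
  filter_upwards [h] with ω hω
  have h2 := hω.add_const (P.qL j)
  rw [zero_add] at h2
  refine h2.congr' ?_
  filter_upwards [eventually_gt_atTop 0] with n hn
  have : (n : ℝ) ≠ 0 := by positivity
  rw [card_arrived, Finset.sum_sub_distrib]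
  push_cast
  simp
  field_simp
  ring

/-- The latency requirement. -/
theorem exists_ae_tendsto_avgLatency (hZ : IsDriver P μ Z) (htie : IsTieRule tie)
    (hθ : ∑ j, P.θ j ≤ 1) (hβ : P.qL j = 1 → 1 ≤ P.β j) :
    ∃ l : ℝ, l ≤ P.β j ∧ ∀ᵐ ω ∂μ,
      Tendsto (avgLatency P T tie (fun t => Z t ω) j) atTop (𝓝 l) := by
  obtain ⟨κ, hκ, h⟩ := exists_ae_tendsto_sum_queue T j hZ htie hθ hβ
  refine ⟨_, hκ, ?_⟩
  filter_upwards [h, ae_tendsto_card_arrived j hZ] with ω h1 h2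
  refine ((h1.add h2).div h2 (P.qL_pos j).ne').congr' ?_
  filter_upwards [eventually_gt_atTop 0] with n hn
  have : (n : ℝ) ≠ 0 := by positivity
  rw [avgLatency, sum_latency P T j htie]
  simp only [Pi.div_apply]
  rw [← add_div, div_div_div_cancel_right₀ this]

/-- A stable queue does not affect the throughput. -/
theorem ae_tendsto_recv_lat (hZ : IsDriver P μ Z) (htie : IsTieRule tie)
    (hθ : ∑ j, P.θ j ≤ 1) (hβ : P.qL j = 1 → 1 ≤ P.β j) :
    ∀ᵐ ω ∂μ, Tendsto (rate P T tie (fun t => Z t ω) (.lat j)) atTop (𝓝 (P.qL j)) := by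
  obtain ⟨κ, hκ, h⟩ := exists_ae_tendsto_sum_queue T j hZ htie hθ hβ
  filter_upwards [h, ae_tendsto_card_arrived j hZ] with ω h1 h2
  have h3 : Tendsto (fun n : ℕ => (queue P T tie j (fun t => Z t ω) n : ℝ) / n) atTop (𝓝 0) := by
    have h4 : Tendsto (fun n : ℕ => ((n : ℝ) + 1) / n) atTop (𝓝 1) := by
      have := (tendsto_inv_atTop_nhds_zero_nat (𝕜 := ℝ)).const_add 1
      rw [add_zero] at this
      refine this.congr' ?_
      filter_upwards [eventually_gt_atTop 0] with n hn
      have : (n : ℝ) ≠ 0 := by positivity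
      field_simp
    have h5 := (((tendsto_add_atTop_iff_nat 1).2 h1).mul h4).sub h1
    rw [mul_one, sub_self] at h5
    refine h5.congr' ?_
    filter_upwards [eventually_gt_atTop 0] with n hn
    have : (n : ℝ) ≠ 0 := by positivity
    have : (n : ℝ) + 1 ≠ 0 := by positivity
    rw [Finset.sum_range_succ]
    push_cast
    field_simp
    ring
  have h6 := h2.sub h3
  rw [sub_zero] at h6
  refine h6.congr fun n => ?_
  rw [← recv_lat_add_queue P T j htie, rate]
  push_cast
  ring

end QueueLimit

/-! ### The throughput of an AoI user -/

section AoI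

variable (P : Params A L R) (T : A → ℝ) (tie : TieRule A L R) (i : A)

/-- The counter of the AoI user `i` may be incremented in slot `n + 1`, in which it is incremented
if a packet arrives. -/
def Eligible (z : ℕ → Input A L R) (n : ℕ) : Prop :=
  ⌈T i - 1 / P.qA i⌉ < ((n + 1 : ℕ) : ℤ) - ((run P T tie z n).a i : ℤ)

noncomputable instance (z : ℕ → Input A L R) (n : ℕ) : Decidable (Eligible P T tie i z n) :=
  Classical.dec _

theorem increments_iff (z : ℕ → Input A L R) (n : ℕ) :
    increments P T (n + 1) (run P T tie z n) (z (n + 1)) i ↔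
      (z (n + 1)).arrA i = true ∧ Eligible P T tie i z n := Iff.rfl

theorem run_b_succ (z : ℕ → Input A L R) (n : ℕ) : (run P T tie z (n + 1)).b i =
    (run P T tie z n).b i +
      if (z (n + 1)).arrA i = true ∧ Eligible P T tie i z n then 1 else 0 := by
  rw [run, step_b]
  simp only [arrivals, increments_iff]
  split_ifs <;> rfl

theorem run_a_succ (z : ℕ → Input A L R) (n : ℕ) : (run P T tie z (n + 1)).a i =
    if (z (n + 1)).arrA i = true ∧ Eligible P T tie i z n then n + 1
      else (run P T tie z n).a i := by
  rw [run, step_a]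
  simp only [arrivals, increments_iff]

variable {tie} in
/-- The counter bounds the number of received packets, since an AoI user is served only while its
index is positive. -/
theorem recv_aoi_le (htie : IsTieRule tie) (z : ℕ → Input A L R) (n : ℕ) :
    (run P T tie z n).recv (.aoi i) ≤ (run P T tie z n).b i ∧
      (0 < (run P T tie z n).W i →
        (run P T tie z n).recv (.aoi i) < (run P T tie z n).b i) := by
  induction n with
  | zero => simp [run, State.init]
  | succ n ih =>
    obtain ⟨ih1, ih2⟩ := ih
    rw [run, step_recv, step_b, step_W]
    set s := run P T tie z n
    have hb : s.b i ≤ (arrivals P T (n + 1) s (z (n + 1))).b i := by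
      simp only [arrivals]
      split_ifs <;> omega
    have hW : 0 < (arrivals P T (n + 1) s (z (n + 1))).W i →
        s.recv (.aoi i) < (arrivals P T (n + 1) s (z (n + 1))).b i := by
      intro h
      by_cases hc : (z (n + 1)).arrA i = true ∧
          s.recv (.aoi i) < (arrivals P T (n + 1) s (z (n + 1))).b i
      · exact hc.2
      · have : (arrivals P T (n + 1) s (z (n + 1))).W i = s.W i := by
          simp only [arrivals] at hc ⊢
          rw [if_neg hc]
        rw [this] at h
        exact (ih2 h).trans_le hb
    split_ifs with h
    · exact ⟨hW (served_aoi P _ _ _ htie h.1), fun h => absurd h (lt_irrefl _)⟩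
    · exact ⟨ih1.trans hb, hW⟩

/-- Every increment of the counter but the last is followed by a full period of slots in which the
user is not eligible. -/
theorem mul_b_le (z : ℕ → Input A L R) (n : ℕ) :
    max ⌈T i - 1 / P.qA i⌉ 0 * ((run P T tie z n).b i : ℤ) ≤
      ∑ l ∈ Finset.range n, (if Eligible P T tie i z l then 0 else 1) +
        max ⌈T i - 1 / P.qA i⌉ 0 := by
  have key : (∑ l ∈ Finset.range n, (if Eligible P T tie i z l then (0 : ℤ) else 1)) ≥
      max ⌈T i - 1 / P.qA i⌉ 0 * ((run P T tie z n).b i : ℤ) -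
        max 0 (max ⌈T i - 1 / P.qA i⌉ 0 - (n - ((run P T tie z n).a i : ℤ))) ∧
      (run P T tie z n).a i ≤ n := by
    induction n with
    | zero => simp [run, State.init]
    | succ n ih =>
      obtain ⟨ih1, ih2⟩ := ih
      rw [Finset.sum_range_succ, run_b_succ, run_a_succ]
      have helig : Eligible P T tie i z n ↔
        ⌈T i - 1 / P.qA i⌉ < ((n + 1 : ℕ) : ℤ) - ((run P T tie z n).a i : ℤ) := Iff.rfl
      have hsum : 0 ≤ ∑ l ∈ Finset.range n, (if Eligible P T tie i z l then (0 : ℤ) else 1) :=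
        Finset.sum_nonneg fun l _ => by split_ifs <;> simp
      generalize (∑ l ∈ Finset.range n, (if Eligible P T tie i z l then (0 : ℤ) else 1)) = E at *
      generalize (run P T tie z n).a i = a at *
      generalize (run P T tie z n).b i = b at *
      generalize ⌈T i - 1 / P.qA i⌉ = m at *
      have hm1 : max m 0 * ((b + 1 : ℕ) : ℤ) = max m 0 * (b : ℤ) + max m 0 := by push_cast; ring
      rcases le_or_gt 0 m with hm | hm
      · rw [max_eq_left hm] at *
        by_cases he : Eligible P T tie i z n
        · have he' := helig.1 he
          by_cases ha : (z (n + 1)).arrA i = true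
          · simp only [he, ha, and_self, if_true, hm1]
            push_cast at he' ⊢
            omega
          · simp only [he, ha, if_true, add_zero, false_and, Bool.false_eq_true, if_false]
            push_cast at he' ⊢
            omega
        · have he' := mt helig.2 he
          simp only [he, and_false, if_false, add_zero]
          push_cast at he' ⊢
          omega
      · rw [max_eq_right hm.le] at *
        simp only [zero_mul] at *
        split_ifs <;> omega
  have ha : (0 : ℤ) ≤ max ⌈T i - 1 / P.qA i⌉ 0 := le_max_right _ _
  obtain ⟨h1, h2⟩ := key
  omega

variable {P} {tie} {Ω : Type*} [MeasurableSpace Ω] {μ : Measure Ω} [IsProbabilityMeasure μ]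
  {Z : ℕ → Ω → Input A L R}

theorem ae_tendsto_b_sub (hZ : IsDriver P μ Z) : ∀ᵐ ω ∂μ, Tendsto (fun n : ℕ =>
    (((run P T tie (fun t => Z t ω) n).b i : ℝ) - P.qA i * ∑ l ∈ Finset.range n,
      (if Eligible P T tie i (fun t => Z t ω) l then 1 else 0)) / n) atTop (𝓝 0) := by
  have q0 := P.qA_pos i
  have q1 := P.qA_le i
  have h := ae_tendsto_sum_div (μ := μ) hZ.measurable hZ.indep hZ.law (K := 1)
    (D := fun n z y => (if Eligible P T tie i z n then (1 : ℝ) else 0) *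
      (((y.arrA i).toNat : ℝ) - P.qA i))
    (fun n z z' h => by
      have : run P T tie z n = run P T tie z' n := run_dependsOn P T tie n h
      have he : Eligible P T tie i z n ↔ Eligible P T tie i z' n := by
        simp only [Eligible, this]
      ext y
      simp only [he])
    (fun n z => by
      rw [sum_inputProb_arrA P i fun b => (if Eligible P T tie i z n then (1 : ℝ) else 0) *
        ((b.toNat : ℝ) - P.qA i)]
      simp only [Fintype.sum_bool, bern, Bool.toNat_true, Bool.toNat_false]
      simp only [if_true, Bool.false_eq_true, if_false]
      push_cast
      ring)
    (fun n z y => by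
      rw [abs_le]
      split_ifs <;> cases y.arrA i <;> constructor <;> simp <;> linarith)
  filter_upwards [h] with ω hω
  refine hω.congr fun n => ?_
  congr 1
  induction n with
  | zero => simp [run, State.init]
  | succ n ih =>
    rw [Finset.sum_range_succ, ih, run_b_succ, Finset.sum_range_succ]
    push_cast
    cases (Z (n + 1) ω).arrA i <;> split_ifs <;> simp_all <;> ring

/-- The throughput of an AoI user is at most the inverse of its target inter-arrival time. -/
theorem ae_rate_aoi_le (hZ : IsDriver P μ Z) (htie : IsTieRule tie) (hT : 1 ≤ T i) :
    ∀ᵐ ω ∂μ, ∃ g : ℕ → ℝ, Tendsto g atTop (𝓝 0) ∧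
      ∀ᶠ n in atTop, rate P T tie (fun t => Z t ω) (.aoi i) n ≤ 1 / T i + g n := by
  filter_upwards [ae_tendsto_b_sub (P := P) (tie := tie) T i hZ] with ω hω
  have q0 := P.qA_pos i
  set z := fun t => Z t ω
  set m : ℤ := max ⌈T i - 1 / P.qA i⌉ 0 with hm
  have hmT : T i ≤ m + 1 / P.qA i := by
    have h1 : T i - 1 / P.qA i ≤ ⌈T i - 1 / P.qA i⌉ := Int.le_ceil _
    have h2 : ((⌈T i - 1 / P.qA i⌉ : ℤ) : ℝ) ≤ m := by exact_mod_cast le_max_left _ _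
    linarith
  have hg := (tendsto_const_div_atTop_nhds_zero_nat (m : ℝ)).add (hω.div_const (P.qA i))
  rw [zero_div, add_zero] at hg
  have hg' := hg.div_const (T i)
  rw [zero_div] at hg'
  refine ⟨_, hg', ?_⟩
  filter_upwards [eventually_gt_atTop 0] with n hn
  have hn' : (0 : ℝ) < n := by exact_mod_cast hn
  have hle : ((run P T tie z n).recv (.aoi i) : ℝ) ≤ (run P T tie z n).b i := by
    exact_mod_cast (recv_aoi_le P T i htie z n).1
  have hb := mul_b_le P T tie i z n
  rw [← hm] at hb
  have hE : ((∑ l ∈ Finset.range n, (if Eligible P T tie i z l then (0 : ℤ) else 1) : ℤ) : ℝ) =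
      n - ∑ l ∈ Finset.range n, (if Eligible P T tie i z l then (1 : ℝ) else 0) := by
    rw [eq_sub_iff_add_eq]
    push_cast
    rw [← Finset.sum_add_distrib, Finset.sum_congr rfl (g := fun _ => (1 : ℝ))]
    · simp
    · intro l _
      split_ifs <;> simp
  have hb' : (m : ℝ) * (run P T tie z n).b i ≤
      (n - ∑ l ∈ Finset.range n, (if Eligible P T tie i z l then (1 : ℝ) else 0)) + m := by
    rw [← hE]
    exact_mod_cast hb
  set E := ∑ l ∈ Finset.range n, (if Eligible P T tie i z l then (1 : ℝ) else 0)
  set b : ℝ := ((run P T tie z n).b i : ℝ)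
  have hb0 : 0 ≤ b := Nat.cast_nonneg _
  have h1 : T i * b ≤ n + m + (b - P.qA i * E) / P.qA i := by
    have h2 := mul_le_mul_of_nonneg_right hmT hb0
    have h3 : (b - P.qA i * E) / P.qA i = 1 / P.qA i * b - E := by field_simp
    rw [h3]
    linarith
  calc rate P T tie z (.aoi i) n ≤ b / n := div_le_div_of_nonneg_right hle hn'.le
    _ ≤ ((n + m + (b - P.qA i * E) / P.qA i) / T i) / n := by
        refine div_le_div_of_nonneg_right ?_ hn'.le
        rw [le_div_iff₀ (by linarith)]
        linarith
    _ = 1 / T i + (m / n + (b - P.qA i * E) / n / P.qA i) / T i := by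
        have : T i ≠ 0 := by linarith
        field_simp
        ring

end AoI

/-! ### Attempts and receptions -/

section Attempts

variable {P : Params A L R} (T : A → ℝ) {tie : TieRule A L R} {Ω : Type*} [MeasurableSpace Ω]
  {μ : Measure Ω} [IsProbabilityMeasure μ] {Z : ℕ → Ω → Input A L R}

/-- In the long run a fraction `p u` of the attempts is successful. -/
theorem ae_tendsto_recv_sub_att (hZ : IsDriver P μ Z) (u : UE A L R) : ∀ᵐ ω ∂μ,
    Tendsto (fun n : ℕ => (((run P T tie (fun t => Z t ω) n).recv u : ℝ) -
      P.p u * (run P T tie (fun t => Z t ω) n).att u) / n) atTop (𝓝 0) := by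
  have p0 := P.p_pos u
  have p1 := P.p_le u
  have h := ae_tendsto_sum_div (μ := μ) hZ.measurable hZ.indep hZ.law (K := 1)
    (D := fun n z y => (if served P tie (n + 1) (arrivals P T (n + 1) (run P T tie z n) y) y =
      some u then (1 : ℝ) else 0) * ((if y.chan u = true then 1 else 0) - P.p u))
    (fun n z z' h => by
      have : run P T tie z n = run P T tie z' n := run_dependsOn P T tie n h
      simp only [this])
    (fun n z => sum_inputProb_chan P u (fun y => if served P tie (n + 1)
      (arrivals P T (n + 1) (run P T tie z n) y) y = some u then (1 : ℝ) else 0)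
      fun _ _ => rfl)
    (fun n z y => by
      rw [abs_le]
      split_ifs <;> constructor <;> simp <;> linarith)
  filter_upwards [h] with ω hω
  refine hω.congr fun n => ?_
  congr 1
  induction n with
  | zero => simp [run, State.init]
  | succ n ih =>
    rw [Finset.sum_range_succ, ih, run, step_recv, step_att]
    push_cast
    split_ifs <;> simp_all <;> ring

theorem recv_le (z : ℕ → Input A L R) (u : UE A L R) (n : ℕ) :
    (run P T tie z n).recv u ≤ n := by
  induction n with
  | zero => simp [run, State.init]
  | succ n ih =>
    rw [run, step_recv]
    split_ifs <;> omega

theorem sum_att [Nonempty R] (z : ℕ → Input A L R) (n : ℕ) :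
    ∑ u, (run P T tie z n).att u = n := by
  induction n with
  | zero => simp [run, State.init]
  | succ n ih =>
    obtain ⟨u, hu⟩ := served_isSome (tie := tie) P (n + 1)
      (arrivals P T (n + 1) (run P T tie z n) (z (n + 1))) (z (n + 1))
    simp only [run, step_att, hu, Option.some.injEq, Finset.sum_add_distrib, ih]
    simp

theorem sum_users (f : UE A L R → ℝ) :
    ∑ u, f u = ∑ i, f (.aoi i) + ∑ j, f (.lat j) + ∑ k, f (.thr k) := by
  let e : A ⊕ L ⊕ R ≃ UE A L R :=
    { toFun := Sum.elim .aoi (Sum.elim .lat .thr)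
      invFun := fun u => match u with
        | .aoi i => .inl i
        | .lat j => .inr (.inl j)
        | .thr k => .inr (.inr k)
      left_inv := by rintro (i | j | k) <;> rfl
      right_inv := by rintro (i | j | k) <;> rfl }
  rw [← e.sum_comp]
  simp only [Fintype.sum_sum_type]
  rw [← add_assoc]
  rfl

end Attempts

/-! ### Serving the largest index -/

section MaxIndex

variable {ι : Type*} [Fintype ι] {x : ι → ℝ} {y : ℕ → ι → ℝ}

/-- Indices grow at the rates `x`, and only a largest index may be decreased by one. If the sum of
the indices is not of linear growth, then no single index is eventually of linear growth: it would
be the turn of the other users only when their indices are of the same order. -/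
theorem frequently_index_le (hx : ∀ k, 0 < x k)
    (hy : ∀ n k, y (n + 1) k = y n k + x k ∨
      (y (n + 1) k = y n k + x k - 1 ∧ ∀ k', y (n + 1) k' ≤ y (n + 1) k + 1))
    (hS : ∀ ε > 0, ∀ᶠ n : ℕ in atTop, ∑ k, y n k ≤ ε * n) (k : ι) {ε : ℝ} (hε : 0 < ε) :
    ∃ᶠ n : ℕ in atTop, y n k ≤ ε * n := by
  intro hcon
  have : Nonempty ι := ⟨k⟩
  obtain ⟨k₁, hk₁⟩ := Finite.exists_min x
  set δ := min ε (x k₁ / 2) with hδdef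
  have hδ : 0 < δ := lt_min hε (half_pos (hx k₁))
  have hδx : ∀ k', δ < x k' := fun k' => by
    have := min_le_right ε (x k₁ / 2)
    linarith [hk₁ k', hx k₁]
  obtain ⟨N, hN⟩ := eventually_atTop.1 hcon
  have hbig : ∀ n ≥ N, δ * n ≤ y n k := fun n hn => by
    have h1 := not_le.1 (hN n hn)
    have h2 : δ * n ≤ ε * n := mul_le_mul_of_nonneg_right (min_le_left _ _) (Nat.cast_nonneg _)
    linarith
  have hall : ∀ k', ∀ᶠ n : ℕ in atTop, δ * n - 1 ≤ y n k' := by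
    intro k'
    obtain ⟨n₀, hn₀, hn₀'⟩ : ∃ n ≥ N, δ * (n : ℕ) - 1 ≤ y n k' := by
      by_contra! hno
      have hgrow : ∀ n : ℕ, y (N + n) k' = y N k' + n * x k' := fun n => by
        induction n with
        | zero => simp
        | succ n ih =>
          rcases hy (N + n) k' with h | ⟨-, h⟩
          · rw [← add_assoc, h, ih]
            push_cast
            ring
          · -- just after its service the index would be within one of the large index of `k`
            have h1 := hno (N + n + 1) (by omega)
            have h2 := hbig (N + n + 1) (by omega)
            linarith [h k]
      obtain ⟨n, hn⟩ := exists_nat_gt ((δ * N - 1 - y N k') / (x k' - δ))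
      rw [div_lt_iff₀ (by linarith [hδx k'])] at hn
      have h1 := hno (N + n) (by omega)
      rw [hgrow] at h1
      push_cast at h1
      nlinarith
    filter_upwards [eventually_ge_atTop n₀] with n hn
    induction n, hn using Nat.le_induction with
    | base => exact hn₀'
    | succ n hn ih =>
      rcases hy n k' with h | ⟨-, h⟩
      · rw [h]
        push_cast
        linarith [hδx k']
      · have := hbig (n + 1) (by omega)
        linarith [h k]
  obtain ⟨M, hM⟩ := exists_nat_gt (2 / δ)
  obtain ⟨n, h1, h2, h3⟩ := ((eventually_all.2 hall).and
    ((hS (δ / 2) (half_pos hδ)).and (eventually_ge_atTop M))).exists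
  have hn : 2 < n * δ := by
    rw [div_lt_iff₀ hδ] at hM
    have : (M : ℝ) ≤ n := by exact_mod_cast h3
    nlinarith
  have h4 : δ * n - 1 ≤ ∑ k', y n k' :=
    (h1 k).trans (Finset.single_le_sum (f := y n) (fun k' _ => by linarith [h1 k'])
      (Finset.mem_univ k))
  linarith

/-- If the sum of the indices is asymptotically linear, then it is shared equally. -/
theorem tendsto_index_div (hx : ∀ k, 0 < x k) (hy0 : ∀ k, y 0 k = 0)
    (hy : ∀ n k, y (n + 1) k = y n k + x k ∨
      (y (n + 1) k = y n k + x k - 1 ∧ ∀ k', y (n + 1) k' ≤ y (n + 1) k + 1))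
    {σ : ℝ} (hσ : 0 ≤ σ)
    (hS : Tendsto (fun n : ℕ => (∑ k, y n k) / n) atTop (𝓝 (-σ))) (k : ι) :
    Tendsto (fun n : ℕ => y n k / n) atTop (𝓝 (-(σ / Fintype.card ι))) := by
  have : Nonempty ι := ⟨k⟩
  set r : ℝ := (Fintype.card ι : ℝ) with hr
  have hr0 : 0 < r := by rw [hr]; exact_mod_cast Fintype.card_pos
  have hlow : ∀ ε > 0, ∀ᶠ n : ℕ in atTop, ∀ k, -(σ / r) - ε ≤ y n k / n := by
    intro ε hε
    set c := σ / r + ε / 2 with hc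
    have hc0 : 0 ≤ c := by positivity
    have hcσ : -(r * c) < -σ := by
      have : r * c = σ + r * (ε / 2) := by rw [hc]; field_simp
      have : 0 < r * (ε / 2) := by positivity
      linarith
    obtain ⟨N, hN⟩ := eventually_atTop.1 (hS.eventually_const_lt hcσ)
    set C := ∑ n ∈ Finset.range (N + 1), |∑ k, y n k|
    have hC0 : 0 ≤ C := Finset.sum_nonneg fun _ _ => abs_nonneg _
    have hsum : ∀ n : ℕ, -(r * c) * n - C ≤ ∑ k, y n k := by
      intro n
      rcases le_or_gt n N with hn | hn
      · have h1 : |∑ k, y n k| ≤ C := Finset.single_le_sum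
          (f := fun n => |∑ k, y n k|) (fun _ _ => abs_nonneg _)
          (Finset.mem_range.2 (Nat.lt_succ_of_le hn))
        have h2 := neg_abs_le (∑ k, y n k)
        have h3 : 0 ≤ r * c * n := by positivity
        linarith
      · have h1 := hN n hn.le
        have h2 : (0 : ℝ) < n := by exact_mod_cast (Nat.zero_le N).trans_lt hn
        rw [lt_div_iff₀ h2] at h1
        linarith
    have hind : ∀ n : ℕ, ∀ k, -c * n - C / r - 1 ≤ y n k := by
      intro n
      have hCr : 0 ≤ C / r := by positivity
      induction n with
      | zero =>
        intro k
        rw [hy0]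
        push_cast
        linarith
      | succ n ih =>
        intro k
        rcases hy n k with h | ⟨-, h⟩
        · rw [h]
          push_cast
          linarith [ih k, hx k]
        · -- the user has just been served, so its index is close to the average
          have h1 : ∑ k', y (n + 1) k' ≤ r * (y (n + 1) k + 1) := by
            rw [mul_add, mul_one]
            have := Finset.sum_le_sum fun k' (_ : k' ∈ Finset.univ) => h k'
            simpa [hr] using this
          have h2 := (hsum (n + 1)).trans h1
          have h3 : r * (-c * ((n + 1 : ℕ) : ℝ) - C / r) ≤ r * (y (n + 1) k + 1) := by
            have : r * (C / r) = C := by field_simp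
            nlinarith
          linarith [le_of_mul_le_mul_left h3 hr0]
    have hlim := tendsto_const_div_atTop_nhds_zero_nat (C / r + 1)
    filter_upwards [hlim.eventually_lt_const (half_pos hε), eventually_gt_atTop 0] with n hn hn0 k
    have hn' : (0 : ℝ) < n := by exact_mod_cast hn0
    have h1 := div_le_div_of_nonneg_right (hind n k) hn'.le
    have h2 : (-c * n - C / r - 1) / n = -c - (C / r + 1) / n := by
      field_simp
      ring
    rw [h2] at h1
    linarith
  rw [Metric.tendsto_atTop']
  intro ε hε
  have hε' : 0 < ε / (2 * (r + 1)) := by positivity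
  obtain ⟨N, hN⟩ := eventually_atTop.1 ((hlow _ hε').and
    (hS.eventually_lt_const (show -σ < -σ + ε / 2 by linarith)))
  refine ⟨N, fun n hn => ?_⟩
  obtain ⟨h1, h2⟩ := hN n hn.le
  have hsingle : y n k / n + σ / r + ε / (2 * (r + 1)) ≤
      ∑ k', (y n k' / n + σ / r + ε / (2 * (r + 1))) :=
    Finset.single_le_sum (f := fun k' => y n k' / n + σ / r + ε / (2 * (r + 1)))
      (fun k' _ => by linarith [h1 k']) (Finset.mem_univ k)
  have htot : ∑ k', (y n k' / n + σ / r + ε / (2 * (r + 1))) =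
      (∑ k', y n k') / n + σ + r * (ε / (2 * (r + 1))) := by
    simp only [Finset.sum_add_distrib, ← Finset.sum_div]
    simp [← hr]
    field_simp
  have h3 : r * (ε / (2 * (r + 1))) + ε / (2 * (r + 1)) = ε / 2 := by field_simp
  have h4 : 0 ≤ r * (ε / (2 * (r + 1))) := by positivity
  rw [Real.dist_eq, abs_lt]
  have := h1 k
  constructor <;> linarith

end MaxIndex

/-! ### The throughput users -/

section Throughput

variable (P : Params A L R) (T : A → ℝ) (tie : TieRule A L R)

/-- Index `α_k t / p_k - R̂_k(t)` of a throughput user at the end of slot `n`. -/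
noncomputable def idx (z : ℕ → Input A L R) (n : ℕ) (k : R) : ℝ :=
  P.α k / P.p (.thr k) * n - (run P T tie z n).att (.thr k)

variable {tie}

theorem idx_succ (htie : IsTieRule tie) (z : ℕ → Input A L R) (n : ℕ) (k : R) :
    idx P T tie z (n + 1) k = idx P T tie z n k + P.α k / P.p (.thr k) ∨
      (idx P T tie z (n + 1) k = idx P T tie z n k + P.α k / P.p (.thr k) - 1 ∧
        ∀ k', idx P T tie z (n + 1) k' ≤ idx P T tie z (n + 1) k + 1) := by
  have hY : ∀ k, Y P (n + 1) (arrivals P T (n + 1) (run P T tie z n) (z (n + 1))) k =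
      idx P T tie z n k + P.α k / P.p (.thr k) := fun k => by
    simp only [Y, idx, arrivals]
    push_cast
    ring
  have hsucc : ∀ k, idx P T tie z (n + 1) k = idx P T tie z n k + P.α k / P.p (.thr k) -
      if served P tie (n + 1) (arrivals P T (n + 1) (run P T tie z n) (z (n + 1))) (z (n + 1)) =
        some (.thr k) then 1 else 0 := fun k => by
    simp only [idx, run, step_att]
    push_cast
    ring
  by_cases h : served P tie (n + 1) (arrivals P T (n + 1) (run P T tie z n) (z (n + 1)))
      (z (n + 1)) = some (.thr k)
  · right
    have hk := hsucc k
    rw [if_pos h] at hk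
    refine ⟨hk, fun k' => ?_⟩
    have h1 := served_thr P _ _ _ htie h k'
    rw [hY, hY] at h1
    have h2 := hsucc k'
    split_ifs at h2 <;> linarith
  · left
    rw [hsucc k, if_neg h, sub_zero]

variable {P} {Ω : Type*} [MeasurableSpace Ω] {μ : Measure Ω} [IsProbabilityMeasure μ]
  {Z : ℕ → Ω → Input A L R}

/-- In the presence of throughput users no slot is idle, so what the AoI and latency users leave
over determines the sum of the indices. -/
theorem sum_idx_div [Nonempty R] (z : ℕ → Input A L R) {n : ℕ} (hn : 0 < n) :
    (∑ k, idx P T tie z n k) / n = ∑ k, P.α k / P.p (.thr k) - 1 +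
      ∑ j, ((run P T tie z n).att (.lat j) : ℝ) / n +
      ∑ i, ((run P T tie z n).att (.aoi i) : ℝ) / n := by
  have hn' : (n : ℝ) ≠ 0 := by positivity
  have h : (∑ u, ((run P T tie z n).att u : ℝ)) = n := by
    exact_mod_cast sum_att (P := P) (tie := tie) T z n
  rw [sum_users] at h
  simp only [idx, Finset.sum_sub_distrib, ← Finset.sum_mul, ← Finset.sum_div]
  field_simp
  linarith

/-- Attempts per slot in terms of receptions per slot. -/
theorem att_div_eq (z : ℕ → Input A L R) (u : UE A L R) (n : ℕ) :
    ((run P T tie z n).att u : ℝ) / n = (rate P T tie z u n - (((run P T tie z n).recv u : ℝ) -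
      P.p u * (run P T tie z n).att u) / n) / P.p u := by
  have := (P.p_pos u).ne'
  rw [rate]
  field_simp
  ring

/-- The throughput requirement. -/
theorem ae_throughput (hθ : ∑ j, P.θ j ≤ 1) (hβ : ∀ j, P.qL j = 1 → 1 ≤ P.β j)
    (hT : P.IsTarget T) (htie : IsTieRule tie) (hZ : IsDriver P μ Z) (k : R) : ∀ᵐ ω ∂μ,
    P.α k ≤ limsup (rate P T tie (fun t => Z t ω) (.thr k)) atTop ∧
      ((∀ i : A, ∃ r, HasThroughput P T tie (fun t => Z t ω) (.aoi i) r) →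
        ∃ r, P.α k ≤ r ∧ HasThroughput P T tie (fun t => Z t ω) (.thr k) r) := by
  have : Nonempty R := ⟨k⟩
  have hatt := ae_all_iff.2 fun u => ae_tendsto_recv_sub_att (P := P) (tie := tie) T hZ u
  have hlat := ae_all_iff.2 fun j => ae_tendsto_recv_lat (P := P) T j hZ htie hθ (hβ j)
  have haoi := ae_all_iff.2 fun i => ae_rate_aoi_le (P := P) T i hZ htie (hT.1.2 i)
  filter_upwards [hatt, hlat, haoi] with ω hatt hlat haoi
  set z := fun t => Z t ω
  have hx : ∀ k, 0 < P.α k / P.p (.thr k) := fun k => div_pos (P.α_pos k) (P.p_pos _)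
  have hidx := idx_succ P T htie z
  have hlat' : Tendsto (fun n : ℕ => ∑ j, ((run P T tie z n).att (.lat j) : ℝ) / n) atTop
      (𝓝 (∑ j, P.qL j / P.p (.lat j))) := by
    refine tendsto_finsetSum _ fun j _ => ?_
    have := ((hlat j).sub (hatt (.lat j))).div_const (P.p (.lat j))
    rw [sub_zero] at this
    exact this.congr fun n => (att_div_eq T z _ n).symm
  choose g hg0 hg using haoi
  have hfeas : ∑ k, P.α k / P.p (.thr k) - 1 + ∑ j, P.qL j / P.p (.lat j) +
      ∑ i, 1 / T i / P.p (.aoi i) ≤ 0 := by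
    have h1 := hT.1.1
    unfold Params.ζ at h1
    have h2 : ∑ i, 1 / T i / P.p (.aoi i) = ∑ i, 1 / (P.p (.aoi i) * T i) :=
      Finset.sum_congr rfl fun i _ => by rw [div_div, mul_comm]
    linarith
  have hS : ∀ ε > 0, ∀ᶠ n : ℕ in atTop, ∑ k, idx P T tie z n k ≤ ε * n := by
    intro ε hε
    have hlim : Tendsto (fun n : ℕ => ∑ k, P.α k / P.p (.thr k) - 1 +
        ∑ j, ((run P T tie z n).att (.lat j) : ℝ) / n + ∑ i, (1 / T i + g i n -
          (((run P T tie z n).recv (.aoi i) : ℝ) -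
            P.p (.aoi i) * (run P T tie z n).att (.aoi i)) / n) / P.p (.aoi i)) atTop
        (𝓝 (∑ k, P.α k / P.p (.thr k) - 1 + ∑ j, P.qL j / P.p (.lat j) +
          ∑ i, 1 / T i / P.p (.aoi i))) := by
      refine (hlat'.const_add _).add (tendsto_finsetSum _ fun i _ => ?_)
      have := (((hg0 i).const_add (1 / T i)).sub (hatt (.aoi i))).div_const (P.p (.aoi i))
      rwa [add_zero, sub_zero] at this
    filter_upwards [hlim.eventually_lt_const (hfeas.trans_lt hε), eventually_all.2 hg,
      eventually_gt_atTop 0] with n h1 h2 hn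
    have hn' : (0 : ℝ) < n := by exact_mod_cast hn
    rw [← div_le_iff₀ hn', sum_idx_div T z hn]
    refine le_trans ?_ h1.le
    refine add_le_add le_rfl (Finset.sum_le_sum fun i _ => ?_)
    rw [att_div_eq]
    exact div_le_div_of_nonneg_right (sub_le_sub_right (h2 i) _) (P.p_pos _).le
  have hrate : ∀ n : ℕ, 0 < n → rate P T tie z (.thr k) n =
      P.α k - P.p (.thr k) * (idx P T tie z n k / n) +
        (((run P T tie z n).recv (.thr k) : ℝ) -
          P.p (.thr k) * (run P T tie z n).att (.thr k)) / n := fun n hn => by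
    have hn' : (n : ℝ) ≠ 0 := by positivity
    have := (P.p_pos (.thr k)).ne'
    rw [rate, idx]
    field_simp
    ring
  constructor
  · have hbdd : IsBoundedUnder (· ≤ ·) atTop (rate P T tie z (.thr k)) :=
      isBoundedUnder_of ⟨1, fun n => by
        have : ((run P T tie z n).recv (.thr k) : ℝ) ≤ n := by exact_mod_cast recv_le T z _ n
        exact div_le_one_of_le₀ this (Nat.cast_nonneg _)⟩
    refine le_of_forall_pos_sub_le fun ε hε => le_limsup_of_frequently_le ?_ hbdd
    have hfreq := frequently_index_le hx hidx hS k (half_pos hε)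
    refine (hfreq.and_eventually (((hatt (.thr k)).eventually_const_lt
      (show -(ε / 2) < 0 by linarith)).and (eventually_gt_atTop 0))).mono ?_
    rintro n ⟨h1, h2, hn⟩
    have hn' : (0 : ℝ) < n := by exact_mod_cast hn
    rw [hrate n hn]
    have h3 : idx P T tie z n k / n ≤ ε / 2 := by rwa [div_le_iff₀ hn']
    have h4 : P.p (.thr k) * (idx P T tie z n k / n) ≤ ε / 2 := by
      nlinarith [P.p_pos (.thr k), P.p_le (.thr k)]
    linarith
  · intro hthr
    choose r hr using hthr
    set σ := -(∑ k, P.α k / P.p (.thr k) - 1 + ∑ j, P.qL j / P.p (.lat j) +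
      ∑ i, r i / P.p (.aoi i)) with hσdef
    have hlim : Tendsto (fun n : ℕ => (∑ k, idx P T tie z n k) / n) atTop (𝓝 (-σ)) := by
      have haoi' : Tendsto (fun n : ℕ => ∑ i, ((run P T tie z n).att (.aoi i) : ℝ) / n) atTop
          (𝓝 (∑ i, r i / P.p (.aoi i))) := by
        refine tendsto_finsetSum _ fun i _ => ?_
        have := ((hr i).sub (hatt (.aoi i))).div_const (P.p (.aoi i))
        rw [sub_zero] at this
        exact this.congr fun n => (att_div_eq T z _ n).symm
      rw [hσdef, neg_neg]
      refine ((hlat'.const_add _).add haoi').congr' ?_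
      filter_upwards [eventually_gt_atTop 0] with n hn
      exact (sum_idx_div T z hn).symm
    have hσ : 0 ≤ σ := by
      refine neg_nonpos.1 (le_of_forall_pos_le_add fun ε hε => ?_)
      rw [zero_add]
      refine le_of_tendsto hlim ?_
      filter_upwards [hS ε hε, eventually_gt_atTop 0] with n h1 hn
      rwa [div_le_iff₀ (by exact_mod_cast hn)]
    have hk := tendsto_index_div hx (fun k => by simp [idx, run, State.init]) hidx hσ hlim k
    refine ⟨P.α k - P.p (.thr k) * -(σ / Fintype.card R), ?_, ?_⟩
    · have : 0 ≤ P.p (.thr k) * (σ / Fintype.card R) :=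
        mul_nonneg (P.p_pos _).le (by positivity)
      linarith
    · have := ((hk.const_mul (P.p (.thr k))).const_sub (P.α k)).add (hatt (.thr k))
      rw [add_zero] at this
      refine this.congr' ?_
      filter_upwards [eventually_gt_atTop 0] with n hn
      exact (hrate n hn).symm

end Throughput

end RDScheduling

theorem mainTheorem4 {A L R : Type*} [Fintype A] [Fintype L] [Fintype R]
    [DecidableEq A] [DecidableEq L] [DecidableEq R]
    (P : RDScheduling.Params A L R)
    (hfeasible : ∑ j, P.qL j / P.p (.lat j) + ∑ k, P.α k / P.p (.thr k) < 1)
    (hθ : ∑ j, P.θ j ≤ 1)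
    (hβ : ∀ j, P.qL j = 1 → 1 ≤ P.β j)
    (T : A → ℝ) (hT : P.IsTarget T)
    (tie : RDScheduling.TieRule A L R) (htie : RDScheduling.IsTieRule tie)
    {Ω : Type*} [MeasurableSpace Ω] (μ : MeasureTheory.Measure Ω)
    [MeasureTheory.IsProbabilityMeasure μ]
    (Z : ℕ → Ω → RDScheduling.Input A L R) (hZ : RDScheduling.IsDriver P μ Z) :
    (∀ j : L, ∃ l : ℝ, l ≤ P.β j ∧ ∀ᵐ ω ∂μ,
      Filter.Tendsto (RDScheduling.avgLatency P T tie (fun t => Z t ω) j) Filter.atTop (nhds l)) ∧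
    (∀ k : R, ∀ᵐ ω ∂μ,
      P.α k ≤ Filter.limsup (RDScheduling.rate P T tie (fun t => Z t ω) (.thr k)) Filter.atTop ∧
      ((∀ i : A, ∃ r, RDScheduling.HasThroughput P T tie (fun t => Z t ω) (.aoi i) r) →
        ∃ r, P.α k ≤ r ∧ RDScheduling.HasThroughput P T tie (fun t => Z t ω) (.thr k) r)) := by
  exact ⟨fun j => RDScheduling.exists_ae_tendsto_avgLatency T j hZ htie hθ (hβ j),
    fun k => RDScheduling.ae_throughput T hθ hβ hT htie hZ k⟩
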